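/- For a positive integer $n$ let $T_n=\mathbb R^2/(\sqrt n\,\mathbb Z)^2$ be the torus of side $\sqrt n$ with the metric $d_T$ inherited from the Euclidean metric. For $r>0$, let $\mathcal T(n,r)$ be the random geometric graph on $n$ vertices whose positions are independent and uniformly distributed on $[0,\sqrt n]^2$ (regarded as points of $T_n$), two distinct vertices being adjacent when the distance $d_T$ between their positions is at most $r$. Let $\mathcal F=\mathcal F(n,r)$ be the family of axis-parallel squares of side length $10^5r$ with left-bottom vertices at the points $(10^4ri,10^4rj)$, where $i,j\ge 0$ are integers with $10^4ri<\sqrt n$ and $10^4rj<\sqrt n$; the squares are regarded as subsets of $T_n$ (they wrap around). For $S\in\mathcal F$, the internal square $I(S)$ is the axis-parallel square of side length $10^5r-2r$ with the same centre as $S$. For a set $W$ of vertices of a graph $G$, the $W$-signature of a vertex $v$ is the vector $(d_G(s,v))_{s\in W}$ of graph distances (with value $\infty$ if there is no path). Let $r=r(n)$ satisfy $70\sqrt{\log n}\le r<\sqrt n/4$ for all sufficiently large $n$, let $G\in\mathcal T(n,r)$, and let $$ w=w(n)=\begin{cases}10^{15}\,r^{4/3} & \text{if } r\ge \log^{3/2}n,\\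 3\cdot10^{16}\log^2 n & \text{if } 100\log n\le r<\log^{3/2}n,\\ 2\cdot 10^{10}\,r^2 & \text{otherwise.}\end{cases} $$ Then, with probability tending to $1$ as $n\to\infty$, the following holds: for every square $S\in\mathcal F$ there is a set $W=W(S)$ of at most $w$ vertices of $G$ lying in $S$ such that the vertices of $G$ lying in $I(S)$ have pairwise distinct $W$-signatures. -/

import Mathlib

open Filter MeasureTheory
open scoped Topology

noncomputable section

namespace LocalizationRGG

/-- The flat torus `ℝ² / (Lℤ)²` with the metric inherited from the Euclidean metric: the
`ℓ²`-product of two circles of length `L`. -/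
abbrev Torus (L : ℝ) : Type := WithLp 2 (AddCircle L × AddCircle L)

/-- The quotient map from the plane to the torus. -/
def toTorus (L : ℝ) (p : ℝ × ℝ) : Torus L :=
  WithLp.toLp 2 ((p.1 : AddCircle L), (p.2 : AddCircle L))

/-- The torus distance between (the classes of) two points of the plane. -/
def torusDist (L : ℝ) (p q : ℝ × ℝ) : ℝ := dist (toTorus L p) (toTorus L q)

/-- The uniform probability distribution on the square `[0, √n]²`. -/
def uniformSquare (n : ℕ) : Measure (ℝ × ℝ) :=
  ProbabilityTheory.cond volume (Set.Icc 0 (√(n : ℝ)) ×ˢ Set.Icc 0 (√(n : ℝ)))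

/-- The joint law of `n` independent uniform points of `[0, √n]²`. -/
def pointsLaw (n : ℕ) : Measure (Fin n → ℝ × ℝ) := Measure.pi fun _ => uniformSquare n

/-- The geometric graph on the torus of side `√n` with vertex positions `x` and threshold
distance `r`. For `x` of law `pointsLaw n` this is the random geometric graph on the torus. -/
def torusGraph {n : ℕ} (r : ℝ) (x : Fin n → ℝ × ℝ) : SimpleGraph (Fin n) where
  Adj i j := i ≠ j ∧ torusDist (√(n : ℝ)) (x i) (x j) ≤ r
  symm := ⟨fun i j h => ⟨h.1.symm, by
    have h2 := h.2
    unfold torusDist at h2 ⊢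
    rwa [dist_comm]⟩⟩
  loopless := ⟨fun _ h => h.1 rfl⟩

/-- The `W`-signature of a vertex `v`: the vector of graph distances from the elements of `W`
to `v` (equal to `⊤` between different components). -/
def signature {V : Type*} (G : SimpleGraph V) (W : Finset V) (v : V) : W → ℕ∞ :=
  fun s => G.edist (s : V) v

/-- Sensors on `W` distinguish the vertices in `A`: no two of them share a `W`-signature. -/
def Distinguishes {V : Type*} (G : SimpleGraph V) (W : Finset V) (A : Set V) : Prop :=
  Set.InjOn (signature G W) A

/-- An axis-parallel square, given by its left-bottom vertex and its side length. -/
structure Square where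
  corner : ℝ × ℝ
  side : ℝ

/-- The points of the plane that belong to the (closed) square. -/
def Square.points (S : Square) : Set (ℝ × ℝ) :=
  Set.Icc S.corner.1 (S.corner.1 + S.side) ×ˢ Set.Icc S.corner.2 (S.corner.2 + S.side)

/-- The internal square `I(S)`: same centre, parallel sides, side length smaller by `2 * r`. -/
def Square.internal (r : ℝ) (S : Square) : Square where
  corner := (S.corner.1 + r, S.corner.2 + r)
  side := S.side - 2 * r

/-- The vertices whose positions on the torus of side `√n` lie in (the image of) the square. -/
def verticesIn {n : ℕ} (x : Fin n → ℝ × ℝ) (S : Square) : Set (Fin n) :=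
  {i | toTorus (√(n : ℝ)) (x i) ∈ toTorus (√(n : ℝ)) '' S.points}

/-- The family `𝓕` of squares of side length `10⁵ r` with left-bottom vertices at the points
`(10⁴ r i, 10⁴ r j)`, `i, j ≥ 0`, both coordinates being smaller than `√n`. -/
def squareFamily (n : ℕ) (r : ℝ) : Set Square :=
  {S | ∃ i j : ℕ, 10 ^ 4 * r * i < √(n : ℝ) ∧ 10 ^ 4 * r * j < √(n : ℝ) ∧
    S = ⟨(10 ^ 4 * r * i, 10 ^ 4 * r * j), 10 ^ 5 * r⟩}

open Classical in
/-- The bound `w` on the number of sensors. -/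
def sensorBound (n : ℕ) (r : ℝ) : ℝ :=
  if Real.log n ^ (3 / 2 : ℝ) ≤ r then 10 ^ 15 * r ^ (4 / 3 : ℝ)
  else if 100 * Real.log n ≤ r then 3 * 10 ^ 16 * Real.log n ^ 2
  else 2 * 10 ^ 10 * r ^ 2

end LocalizationRGG

end

/-! Only graph distances 0 and 1 are needed. A sensor is told apart from every other vertex, and a
sensor in exactly one of the two discs of radius `r` around `i` and `j` is adjacent to exactly one
of them. For `i`, `j` in `I(S)` all such sensors lie in `S`. If `i` and `j` are at sup distance `d`,
the symmetric difference of the discs has area at least `r * min d r`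
(`ofReal_le_volume_discSymmDiff`). With high probability it then contains at least a fixed fraction
of that many vertices, as soon as the area exceeds a multiple of `log n`
(`measure_exists_pairHits_le`).

For `r < 100 log n` with `r < log^{3/2} n`, all vertices of the square serve as sensors: their
expected number is at most `10^10 r^2`, and a Chernoff bound allows twice that. Otherwise let `l =
max (log n) (r^{2/3})`, `δ = 10 l / r`, and choose sensors in the square at random with density `p =
10^4 l^2 / r^2`, which gives order `l^2` of them. For `k` up to a cutoff `K`, a pair at distance
more than `k δ` is missed with probability at most `exp (-5000 k l^3 / r^2) ≤ 8^{-k}`.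

The close pairs are controlled by first-moment bounds on disjoint stars
(`measure_exists_starPacking_le`). There are fewer than `m`, of order `l^2`, disjoint pairs at
distance at most `δ`, so the vertices of a maximal family cover all such pairs and can be added as
sensors. Likewise, for `K > 1`, a small set meets all cherries of radius `K δ`. Once these vertices
are removed, the pairs within `K δ` form a matching, of which fewer than `4^k m` have distance at
most `(k + 1) δ`. Hence the expected number of missed near pairs is at most `∑ 4^k m 8^{-k} ≤ m`.
Beyond `K δ` the miss probability is below the inverse of the number of pairs. Adding one endpoint
of each missed pair finishes the choice (`exists_resolving_set`). All failure events have
probability of order `exp (-5 l) ≤ n^{-5}`, which survives the union over squares, scales and pairs.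
-/

namespace LocalizationRGG

open ProbabilityTheory

/-! ### Coordinates of independent samples -/

section Independent

variable {T ι κ : Type*} [MeasurableSpace T] [Fintype ι] [Fintype κ] (ν : Measure T)
  [IsProbabilityMeasure ν]

theorem measurePreserving_comp_injective {φ : κ → ι} (hφ : Function.Injective φ) :
    MeasurePreserving (fun (y : ι → T) (k : κ) => y (φ k)) (Measure.pi fun _ => ν)
      (Measure.pi fun _ => ν) := by
  refine ⟨by fun_prop, ?_⟩
  have h : iIndepFun (fun (i : ι) (y : ι → T) => y i) (Measure.pi fun _ : ι => ν) :=
    iIndepFun_pi (X := fun _ => id) fun _ => aemeasurable_id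
  have h2 := (h.precomp hφ).map_fun_eq_pi_map (fun k => (measurable_pi_apply (φ k)).aemeasurable)
  rw [h2]
  congr 1
  funext k
  exact (measurePreserving_eval (fun _ : ι => ν) (φ k)).map_eq

/-- Two disjoint blocks of coordinates are independent, so Fubini allows one block to be fixed while
the other is estimated. -/
theorem measurePreserving_comp_sum {κ' : Type*} [Fintype κ'] {φ : κ ⊕ κ' → ι}
    (hφ : Function.Injective φ) :
    MeasurePreserving (fun (y : ι → T) => (fun k => y (φ (.inl k)), fun k => y (φ (.inr k))))
      (Measure.pi fun _ => ν)
      ((Measure.pi fun _ : κ => ν).prod (Measure.pi fun _ : κ' => ν)) :=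
  (measurePreserving_sumPiEquivProdPi (fun _ : κ ⊕ κ' => ν)).comp
    (measurePreserving_comp_injective ν hφ)

end Independent

/-! ### Chernoff bounds for the number of points in a set -/

section HitCount

variable {T ι : Type*} [Fintype ι]

open Classical in
/-- The number of coordinates of `y` that lie in `A`. -/
noncomputable def hitCount (A : Set T) (y : ι → T) : ℕ := (Finset.univ.filter fun i => y i ∈ A).card

theorem hitCount_eq_sum (A : Set T) (y : ι → T) :
    (hitCount A y : ℝ) = ∑ i, A.indicator (fun _ => (1 : ℝ)) (y i) := by
  classical
  simp [hitCount, Set.indicator_apply]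

theorem hitCount_le_card (A : Set T) (y : ι → T) : hitCount A y ≤ Fintype.card ι :=
  Finset.card_le_univ _

variable [MeasurableSpace T] (ν : Measure T) [IsProbabilityMeasure ν]

theorem measurable_hitCount {A : Set T} (hA : MeasurableSet A) :
    Measurable fun y : ι → T => (hitCount A y : ℝ) := by
  simp_rw [hitCount_eq_sum]
  exact Finset.measurable_sum _ fun i _ =>
    (measurable_const.indicator hA).comp (measurable_pi_apply i)

theorem integrable_exp_hitCount {A : Set T} (hA : MeasurableSet A) (t : ℝ) :
    Integrable (fun y : ι → T => Real.exp (t * hitCount A y)) (Measure.pi fun _ => ν) := by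
  refine Integrable.of_bound (C := Real.exp (|t| * Fintype.card ι))
    ((measurable_hitCount hA).const_mul t).exp.aestronglyMeasurable (ae_of_all _ fun y => ?_)
  rw [Real.norm_eq_abs, Real.abs_exp, Real.exp_le_exp]
  have h1 : (hitCount A y : ℝ) ≤ Fintype.card ι := mod_cast hitCount_le_card A y
  calc t * hitCount A y ≤ |t| * hitCount A y := by gcongr; exact le_abs_self t
    _ ≤ _ := by gcongr

/-- Each coordinate contributes a factor `1 + ν(A) (e^t - 1)`, which is at most its exponential: the
binomial law is compared with the Poisson law. -/
theorem mgf_hitCount_le {A : Set T} (hA : MeasurableSet A) (t : ℝ) :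
    mgf (fun y : ι → T => (hitCount A y : ℝ)) (Measure.pi fun _ => ν) t ≤
      Real.exp (Fintype.card ι * ν.real A * (Real.exp t - 1)) := by
  have h1 : mgf (fun y : ι → T => (hitCount A y : ℝ)) (Measure.pi fun _ => ν) t =
      ∏ _i : ι, ∫ x, Real.exp (t * A.indicator (fun _ => (1 : ℝ)) x) ∂ν := by
    rw [← integral_fintype_prod_eq_prod]
    simp only [mgf, hitCount_eq_sum, Finset.mul_sum, Real.exp_sum]
  have h2 : ∫ x, Real.exp (t * A.indicator (fun _ => (1 : ℝ)) x) ∂ν =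
      1 + ν.real A * (Real.exp t - 1) := by
    have h3 : ∀ x, Real.exp (t * A.indicator (fun _ => (1 : ℝ)) x) =
        1 + A.indicator (fun _ => Real.exp t - 1) x := by
      intro x
      by_cases hx : x ∈ A <;> simp [hx]
    simp_rw [h3]
    rw [integral_add (integrable_const _) ((integrable_const _).indicator hA),
      integral_indicator_const _ hA]
    simp
  rw [h1, h2, Finset.prod_const, Finset.card_univ, mul_assoc, Real.exp_nat_mul]
  have h0 : 0 ≤ 1 + ν.real A * (Real.exp t - 1) := by
    have : ν.real A ≤ 1 := measureReal_le_one
    have : 0 ≤ ν.real A := measureReal_nonneg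
    nlinarith [Real.exp_pos t]
  gcongr
  linarith [Real.add_one_le_exp (ν.real A * (Real.exp t - 1))]

/-- Chernoff at `t = log 2`, where `2 log 2 - 1 > 1/4`. -/
theorem measureReal_two_mul_le_hitCount_le {A : Set T} (hA : MeasurableSet A) {a : ℝ}
    (ha : Fintype.card ι * ν.real A ≤ a) :
    (Measure.pi fun _ : ι => ν).real {y | 2 * a ≤ hitCount A y} ≤ Real.exp (-(a / 4)) := by
  have ha0 : 0 ≤ a := le_trans (by positivity) ha
  have hlog : (0.69 : ℝ) < Real.log 2 := by linarith [Real.log_two_gt_d9]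
  refine (measure_ge_le_exp_mul_mgf (2 * a) (t := Real.log 2) (by linarith)
    (integrable_exp_hitCount ν hA _)).trans ?_
  refine (mul_le_mul_of_nonneg_left (mgf_hitCount_le ν hA _) (Real.exp_nonneg _)).trans ?_
  rw [← Real.exp_add, Real.exp_le_exp, Real.exp_log two_pos]
  nlinarith

/-- Chernoff at `t = -1`, where `1 - e⁻¹ ≥ 3/5`. -/
theorem measureReal_hitCount_le_le {A : Set T} (hA : MeasurableSet A) {a : ℝ}
    (ha : a ≤ Fintype.card ι * ν.real A) (b : ℝ) :
    (Measure.pi fun _ : ι => ν).real {y | (hitCount A y : ℝ) ≤ b} ≤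
      Real.exp (b - 3 / 5 * a) := by
  refine (measure_le_le_exp_mul_mgf b (t := -1) (by norm_num)
    (integrable_exp_hitCount ν hA _)).trans ?_
  refine (mul_le_mul_of_nonneg_left (mgf_hitCount_le ν hA _) (Real.exp_nonneg _)).trans ?_
  rw [← Real.exp_add, Real.exp_le_exp]
  have he : Real.exp (-1) ≤ 2 / 5 := by
    rw [Real.exp_neg]
    have := Real.exp_one_gt_d9
    rw [inv_le_comm₀ (Real.exp_pos _) (by norm_num)]
    norm_num; linarith
  have h0 : 0 ≤ Fintype.card ι * ν.real A := by positivity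
  nlinarith

end HitCount

/-! ### Packings of disjoint stars and their probability -/

section StarPacking

variable {ι : Type*}

/-- The vertices of the star with centre `c` and leaves `g c b`: the centre is `(c, none)`, the leaf
`g c b` is `(c, some b)`. -/
def starVertex {s : ℕ} (g : ι → Fin s → ι) (p : ι × Option (Fin s)) : ι := p.2.elim p.1 (g p.1)

/-- The stars with centres `c ∈ C` and leaves `g c b` are vertex disjoint, their centres satisfy
`P`, and their centres and leaves are related by `Q`. -/
structure IsStarPacking (P : ι → Prop) (Q : ι → ι → Prop) {s : ℕ} (C : Finset ι)
    (g : ι → Fin s → ι) : Prop where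
  injOn : Set.InjOn (starVertex g) {p | p.1 ∈ C}
  center : ∀ c ∈ C, P c
  leaf : ∀ c ∈ C, ∀ b, Q c (g c b)

end StarPacking

section PackingProbability

variable {T : Type*} [MeasurableSpace T] {n : ℕ} (ν : Measure T) [IsProbabilityMeasure ν]

/-- The vertices of disjoint stars are distinct indices, hence independent. With the centres fixed,
every leaf costs a factor `γ`; integrating over the centres gives a factor `β` for each. -/
theorem measure_stars_le {B : Set T} (hB : MeasurableSet B) {R : Set (T × T)}
    (hR : MeasurableSet R) {s : ℕ} {C : Finset (Fin n)} {g : Fin n → Fin s → Fin n}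
    (hinj : Set.InjOn (starVertex g) {p | p.1 ∈ C}) {β γ : ENNReal}
    (hβ : ν B ≤ β) (hγ : ∀ u, ν (Prod.mk u ⁻¹' R) ≤ γ) :
    (Measure.pi fun _ : Fin n => ν)
      {y | ∀ c ∈ C, y c ∈ B ∧ ∀ b, (y c, y (g c b)) ∈ R} ≤ (β * γ ^ s) ^ C.card := by
  classical
  let φ : C ⊕ (C × Fin s) → Fin n := Sum.elim (fun c => c) (fun p => g p.1 p.2)
  have hφ : Function.Injective φ := by
    rintro (a | a) (b | b) h
    · exact congrArg _ (Subtype.ext h)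
    · have := @hinj (a.1, none) a.2 (b.1.1, some b.2) b.1.2 h
      simp at this
    · have := @hinj (a.1.1, some a.2) a.1.2 (b.1, none) b.2 h
      simp at this
    · have := @hinj (a.1.1, some a.2) a.1.2 (b.1.1, some b.2) b.1.2 h
      simp only [Prod.mk.injEq, Option.some.injEq] at this
      exact congrArg _ (Prod.ext (Subtype.ext this.1) this.2)
  let E : Set ((C → T) × (C × Fin s → T)) :=
    {q | (∀ c, q.1 c ∈ B) ∧ ∀ p, (q.1 p.1, q.2 p) ∈ R}
  have hE : MeasurableSet E := by
    have h : E = (⋂ c, {q | q.1 c ∈ B}) ∩ ⋂ p : C × Fin s, {q | (q.1 p.1, q.2 p) ∈ R} := by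
      ext q
      simp [E]
    rw [h]
    exact (MeasurableSet.iInter fun c => hB.preimage (by fun_prop)).inter
      (MeasurableSet.iInter fun p => hR.preimage (by fun_prop))
  have hpre : {y : Fin n → T | ∀ c ∈ C, y c ∈ B ∧ ∀ b, (y c, y (g c b)) ∈ R} =
      (fun y => (fun k => y (φ (.inl k)), fun k => y (φ (.inr k)))) ⁻¹' E := by
    ext y
    simp only [Set.mem_ofPred_eq, E, Set.mem_preimage, φ, Sum.elim_inl, Sum.elim_inr]
    constructor
    · exact fun h => ⟨fun c => (h c c.2).1, fun p => (h p.1 p.1.2).2 p.2⟩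
    · exact fun h c hc => ⟨h.1 ⟨c, hc⟩, fun b => h.2 (⟨c, hc⟩, b)⟩
  rw [hpre, (measurePreserving_comp_sum ν hφ).measure_preimage hE.nullMeasurableSet,
    Measure.prod_apply hE]
  have hsec : ∀ u : C → T, (Measure.pi fun _ : C × Fin s => ν) (Prod.mk u ⁻¹' E) ≤
      (Set.univ.pi fun _ => B).indicator (fun _ => (γ ^ s) ^ C.card) u := by
    intro u
    by_cases hu : ∀ c, u c ∈ B
    · have h1 : Prod.mk u ⁻¹' E = Set.univ.pi fun p : C × Fin s => Prod.mk (u p.1) ⁻¹' R := by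
        ext v
        simp [E, hu]
      rw [h1, Measure.pi_pi, Set.indicator_of_mem (by simpa using hu)]
      calc ∏ p : C × Fin s, ν (Prod.mk (u p.1) ⁻¹' R) ≤ ∏ p : C × Fin s, γ :=
            Finset.prod_le_prod' fun p _ => hγ _
        _ = (γ ^ s) ^ C.card := by
            rw [Finset.prod_const, ← pow_mul, Finset.card_univ, Fintype.card_prod]
            simp [mul_comm]
    · have h1 : Prod.mk u ⁻¹' E = ∅ := by
        ext v
        simp only [Set.mem_preimage, Set.mem_ofPred_eq, E, Set.mem_empty_iff_false, iff_false]
        exact fun h => hu h.1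
      simp [h1]
  calc _ ≤ ∫⁻ u, (Set.univ.pi fun _ => B).indicator (fun _ => (γ ^ s) ^ C.card) u
        ∂(Measure.pi fun _ : C => ν) := lintegral_mono hsec
    _ = (γ ^ s) ^ C.card * (ν B) ^ C.card := by
        rw [lintegral_indicator_const (MeasurableSet.univ_pi fun _ => hB), Measure.pi_pi]
        simp
    _ ≤ _ := by
        rw [mul_pow, mul_comm]
        gcongr

/-- First-moment method: about `n^m / m!` choices of centres and `n^{sm}` of leaves cancel the
powers of `n` in the probability, leaving `(β γ^s)^m / m! ≤ (e / 6)^m`. -/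
theorem measure_exists_starPacking_le {B : Set T} (hB : MeasurableSet B) {R : Set (T × T)}
    (hR : MeasurableSet R) (s m : ℕ) {β γ : ℝ} (hβ0 : 0 ≤ β) (hγ0 : 0 ≤ γ)
    (hβ : ν B ≤ ENNReal.ofReal (β / n)) (hγ : ∀ u, ν (Prod.mk u ⁻¹' R) ≤ ENNReal.ofReal (γ / n))
    (hm : 6 * (β * γ ^ s) ≤ m) :
    (Measure.pi fun _ : Fin n => ν)
      {y | ∃ (C : Finset (Fin n)) (g : Fin n → Fin s → Fin n), C.card = m ∧
        IsStarPacking (fun i => y i ∈ B) (fun i j => (y i, y j) ∈ R) C g} ≤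
      ENNReal.ofReal ((1 / 2) ^ m) := by
  classical
  rcases Nat.eq_zero_or_pos m with rfl | hm0
  · simpa using prob_le_one
  rcases Nat.eq_zero_or_pos n with rfl | hn
  · have : {y : Fin 0 → T | ∃ (C : Finset (Fin 0)) (g : Fin 0 → Fin s → Fin 0), C.card = m ∧
        IsStarPacking (fun i => y i ∈ B) (fun i j => (y i, y j) ∈ R) C g} = ∅ := by
      ext y
      simp only [Set.mem_ofPred_eq, Set.mem_empty_iff_false, iff_false]
      rintro ⟨C, g, hC, -⟩
      have : C = ∅ := Subsingleton.elim _ _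
      simp [this] at hC
      omega
    rw [this]
    simp
  have hn' : (0 : ℝ) < n := by exact_mod_cast hn
  -- Leaves are chosen only for centres in `C`, so that the union bound runs over `n^{sm}` maps; the
  -- value off `C` plays no role.
  let ext : (C : Finset (Fin n)) → (C → Fin s → Fin n) → Fin n → Fin s → Fin n :=
    fun C g c => if h : c ∈ C then g ⟨c, h⟩ else fun _ => c
  have hsub : {y : Fin n → T | ∃ (C : Finset (Fin n)) (g : Fin n → Fin s → Fin n), C.card = m ∧
        IsStarPacking (fun i => y i ∈ B) (fun i j => (y i, y j) ∈ R) C g} ⊆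
      ⋃ C ∈ (Finset.univ : Finset (Fin n)).powersetCard m, ⋃ g ∈ (Finset.univ : Finset (C → Fin s → Fin n)),
        {y | Set.InjOn (starVertex (ext C g)) {p | p.1 ∈ C} ∧
          ∀ c ∈ C, y c ∈ B ∧ ∀ b, (y c, y (ext C g c b)) ∈ R} := by
    rintro y ⟨C, g, hC, h⟩
    have hext : ∀ c ∈ C, ext C (fun c => g c) c = g c := fun c hc => by simp [ext, hc]
    simp only [Set.mem_iUnion]
    refine ⟨C, Finset.mem_powersetCard.2 ⟨Finset.subset_univ _, hC⟩, fun c => g c,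
      Finset.mem_univ _, ?_, fun c hc => ⟨h.center c hc, fun b => ?_⟩⟩
    · refine h.injOn.congr fun p hp => ?_
      simp only [starVertex]
      rw [hext p.1 hp]
    · rw [hext c hc]
      exact h.leaf c hc b
  have hone : ∀ C ∈ (Finset.univ : Finset (Fin n)).powersetCard m, ∀ g : C → Fin s → Fin n,
      (Measure.pi fun _ : Fin n => ν) {y | Set.InjOn (starVertex (ext C g)) {p | p.1 ∈ C} ∧
          ∀ c ∈ C, y c ∈ B ∧ ∀ b, (y c, y (ext C g c b)) ∈ R} ≤
        ENNReal.ofReal ((β / n * (γ / n) ^ s) ^ m) := by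
    intro C hC g
    by_cases hinj : Set.InjOn (starVertex (ext C g)) {p | p.1 ∈ C}
    · simp only [hinj, true_and]
      refine (measure_stars_le ν hB hR hinj hβ hγ).trans_eq ?_
      rw [(Finset.mem_powersetCard.1 hC).2, ENNReal.ofReal_pow (by positivity),
        ENNReal.ofReal_mul (by positivity), ENNReal.ofReal_pow (by positivity)]
    · simp [hinj]
  have hfac : (m : ℝ) ^ m / m.factorial ≤ Real.exp m := 
    Real.pow_div_factorial_le_exp _ (by positivity) m
  calc _ ≤ ∑ C ∈ (Finset.univ : Finset (Fin n)).powersetCard m,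
        ∑ g ∈ (Finset.univ : Finset (C → Fin s → Fin n)),
          ENNReal.ofReal ((β / n * (γ / n) ^ s) ^ m) := by
        refine (measure_mono hsub).trans ((measure_biUnion_finset_le _ _).trans ?_)
        refine Finset.sum_le_sum fun C hC => (measure_biUnion_finset_le _ _).trans ?_
        exact Finset.sum_le_sum fun g _ => hone C hC g
    _ = ∑ C ∈ (Finset.univ : Finset (Fin n)).powersetCard m,
          ENNReal.ofReal (((n : ℝ) ^ s) ^ m * (β / n * (γ / n) ^ s) ^ m) := by
        refine Finset.sum_congr rfl fun C hC => ?_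
        rw [Finset.sum_const, nsmul_eq_mul, ENNReal.ofReal_mul (by positivity)]
        congr 1
        rw [Finset.card_univ, Fintype.card_fun, Fintype.card_fun, Fintype.card_coe,
          (Finset.mem_powersetCard.1 hC).2, Fintype.card_fin, Fintype.card_fin,
          ENNReal.ofReal_pow (by positivity), ENNReal.ofReal_pow (by positivity)]
        simp
    _ = ENNReal.ofReal ((n.choose m : ℝ) * (((n : ℝ) ^ s) ^ m * (β / n * (γ / n) ^ s) ^ m)) := by
        rw [Finset.sum_const, Finset.card_powersetCard, nsmul_eq_mul, Finset.card_univ,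
          Fintype.card_fin, ENNReal.ofReal_mul (p := (n.choose m : ℝ)) (by positivity),
          ENNReal.ofReal_natCast]
    _ ≤ _ := by
        refine ENNReal.ofReal_le_ofReal ?_
        calc (n.choose m : ℝ) * (((n : ℝ) ^ s) ^ m * (β / n * (γ / n) ^ s) ^ m)
            ≤ (n : ℝ) ^ m / m.factorial * (((n : ℝ) ^ s) ^ m * (β / n * (γ / n) ^ s) ^ m) := by
              gcongr
              exact Nat.choose_le_pow_div m n
          _ = (β * γ ^ s) ^ m / m.factorial := by
              rw [div_mul_eq_mul_div, ← mul_pow, ← mul_pow]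
              congr 2
              rw [div_pow]
              field_simp
          _ ≤ (m / 6 : ℝ) ^ m / m.factorial := by
              gcongr
              linarith
          _ = (1 / 6) ^ m * ((m : ℝ) ^ m / m.factorial) := by
              rw [div_pow, one_div, inv_pow]
              field_simp
          _ ≤ (1 / 6) ^ m * Real.exp m := by gcongr
          _ = (1 / 6 * Real.exp 1) ^ m := by rw [mul_pow, ← Real.exp_nat_mul, mul_one]
          _ ≤ (1 / 2) ^ m := by
              gcongr
              linarith [Real.exp_one_lt_d9]

end PackingProbability

/-! ### Lower bounds on hits that depend on a pair of points -/

section PairHitCount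

variable {T : Type*} [MeasurableSpace T] {n : ℕ} (ν : Measure T) [IsProbabilityMeasure ν]

open Classical in
/-- The indices `k` other than `i` and `j` with `((y i, y j), y k) ∈ R`. -/
noncomputable def pairHits (R : Set ((T × T) × T)) (y : Fin n → T) (i j : Fin n) : Finset (Fin n) :=
  Finset.univ.filter fun k => k ≠ i ∧ k ≠ j ∧ ((y i, y j), y k) ∈ R

theorem measure_pairHits_le {R : Set ((T × T) × T)} (hR : MeasurableSet R) {f : T × T → ℝ}
    (hf : Measurable f) (hfR : ∀ q, f q ≤ n * ν.real (Prod.mk q ⁻¹' R)) (hn : 100 ≤ n) {s : ℝ}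
    (hs : 0 ≤ s) {i j : Fin n} (hij : i ≠ j) :
    (Measure.pi fun _ : Fin n => ν)
      {y | s ≤ f (y i, y j) ∧ ((pairHits R y i j).card : ℝ) ≤ f (y i, y j) / 20} ≤
      ENNReal.ofReal (Real.exp (-(s / 2))) := by
  classical
  let J := {k : Fin n // k ≠ i ∧ k ≠ j}
  let φ : Fin 2 ⊕ J → Fin n := Sum.elim ![i, j] Subtype.val
  have hφ : Function.Injective φ := by
    refine Function.Injective.sumElim ?_ Subtype.val_injective ?_
    · intro a b h
      fin_cases a <;> fin_cases b <;> simp_all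
    · intro a b h
      fin_cases a
      · exact b.2.1 h.symm
      · exact b.2.2 h.symm
  let E : Set ((Fin 2 → T) × (J → T)) := {q | s ≤ f (q.1 0, q.1 1) ∧
    (hitCount (Prod.mk (q.1 0, q.1 1) ⁻¹' R) q.2 : ℝ) ≤ f (q.1 0, q.1 1) / 20}
  have hE : MeasurableSet E := by
    have h1 : Measurable fun q : (Fin 2 → T) × (J → T) => f (q.1 0, q.1 1) :=
      hf.comp (by fun_prop)
    refine MeasurableSet.inter (measurableSet_le measurable_const h1)
      (measurableSet_le ?_ (h1.div_const _))
    simp_rw [hitCount_eq_sum]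
    refine Finset.measurable_sum _ fun k _ => ?_
    have h2 : (fun q : (Fin 2 → T) × (J → T) =>
        (Prod.mk (q.1 0, q.1 1) ⁻¹' R).indicator (fun _ => (1 : ℝ)) (q.2 k)) =
        (R.indicator fun _ => (1 : ℝ)) ∘ fun q => ((q.1 0, q.1 1), q.2 k) := by
      ext q
      simp [Set.indicator_apply]
    rw [h2]
    exact (measurable_const.indicator hR).comp (by fun_prop)
  have hpre : {y : Fin n → T | s ≤ f (y i, y j) ∧
      ((pairHits R y i j).card : ℝ) ≤ f (y i, y j) / 20} =
      (fun y => (fun k => y (φ (.inl k)), fun k => y (φ (.inr k)))) ⁻¹' E := by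
    ext y
    have h3 : hitCount (Prod.mk (y i, y j) ⁻¹' R) (fun k : J => y k) =
        (pairHits R y i j).card := by
      refine Finset.card_bij (fun k _ => k.1) ?_ (fun a _ b _ h => Subtype.ext h) ?_
      · intro k hk
        simp only [Finset.mem_filter, Finset.mem_univ, true_and, pairHits] at hk ⊢
        exact ⟨k.2.1, k.2.2, hk⟩
      · intro k hk
        simp only [Finset.mem_filter, Finset.mem_univ, true_and, pairHits] at hk
        exact ⟨⟨k, hk.1, hk.2.1⟩, by simpa using hk.2.2, rfl⟩
    simp [E, φ, h3]
  have hcard : (Fintype.card J : ℝ) = n - 2 := by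
    have h4 : Fintype.card J = n - 2 := by
      have h5 : (Finset.univ.filter fun k : Fin n => k ≠ i ∧ k ≠ j) = {i, j}ᶜ := by
        ext k
        simp
      rw [Fintype.card_subtype, h5, Finset.card_compl, Finset.card_pair hij, Fintype.card_fin]
    rw [h4, Nat.cast_sub (by omega)]
    norm_num
  rw [hpre, (measurePreserving_comp_sum ν hφ).measure_preimage hE.nullMeasurableSet,
    Measure.prod_apply hE]
  have hsec : ∀ u : Fin 2 → T, (Measure.pi fun _ : J => ν) (Prod.mk u ⁻¹' E) ≤
      ENNReal.ofReal (Real.exp (-(s / 2))) := by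
    intro u
    by_cases hu : s ≤ f (u 0, u 1)
    · have h6 : Prod.mk u ⁻¹' E = {z | (hitCount (Prod.mk (u 0, u 1) ⁻¹' R) z : ℝ) ≤
          f (u 0, u 1) / 20} := by
        ext z
        simp [E, hu]
      rw [h6, ← ofReal_measureReal]
      -- The factor `19/20` absorbs the two excluded indices, since `n ≥ 100`. The exponent is then
      -- `1/20 - (3/5)(19/20) = -0.52` times `f`.
      refine ENNReal.ofReal_le_ofReal ((measureReal_hitCount_le_le ν
        (hR.preimage measurable_prodMk_left) (a := 19 / 20 * f (u 0, u 1)) ?_ _).trans ?_)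
      · rw [hcard]
        have h7 := hfR (u 0, u 1)
        have h8 : (100 : ℝ) ≤ n := by exact_mod_cast hn
        have h9 : 0 ≤ ν.real (Prod.mk (u 0, u 1) ⁻¹' R) := measureReal_nonneg
        nlinarith
      · rw [Real.exp_le_exp]
        linarith
    · have h6 : Prod.mk u ⁻¹' E = ∅ := by
        ext z
        simp [E, hu]
      simp [h6]
  calc _ ≤ ∫⁻ _, ENNReal.ofReal (Real.exp (-(s / 2))) ∂(Measure.pi fun _ : Fin 2 => ν) :=
        lintegral_mono hsec
    _ = _ := by simp

theorem measure_exists_pairHits_le {R : Set ((T × T) × T)} (hR : MeasurableSet R) {f : T × T → ℝ}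
    (hf : Measurable f) (hfR : ∀ q, f q ≤ n * ν.real (Prod.mk q ⁻¹' R)) (hn : 100 ≤ n) {s : ℝ}
    (hs : 0 ≤ s) :
    (Measure.pi fun _ : Fin n => ν)
      {y | ∃ i j, i ≠ j ∧ s ≤ f (y i, y j) ∧
        ((pairHits R y i j).card : ℝ) ≤ f (y i, y j) / 20} ≤
      ENNReal.ofReal (n ^ 2 * Real.exp (-(s / 2))) := by
  have hsub : {y : Fin n → T | ∃ i j, i ≠ j ∧ s ≤ f (y i, y j) ∧
        ((pairHits R y i j).card : ℝ) ≤ f (y i, y j) / 20} ⊆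
      ⋃ i ∈ (Finset.univ : Finset (Fin n)), ⋃ j ∈ (Finset.univ : Finset (Fin n)),
        {y | i ≠ j ∧ s ≤ f (y i, y j) ∧
          ((pairHits R y i j).card : ℝ) ≤ f (y i, y j) / 20} := by
    rintro y ⟨i, j, h⟩
    simp only [Set.mem_iUnion]
    exact ⟨i, Finset.mem_univ _, j, Finset.mem_univ _, h⟩
  calc _ ≤ ∑ _i : Fin n, ∑ _j : Fin n, ENNReal.ofReal (Real.exp (-(s / 2))) := by
        refine (measure_mono hsub).trans ((measure_biUnion_finset_le _ _).trans ?_)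
        refine Finset.sum_le_sum fun i _ => (measure_biUnion_finset_le _ _).trans ?_
        refine Finset.sum_le_sum fun j _ => ?_
        by_cases hij : i = j
        · simp [hij]
        · simpa [hij] using measure_pairHits_le ν hR hf hfR hn hs hij
    _ = _ := by
        rw [ENNReal.ofReal_mul (by positivity), ENNReal.ofReal_pow (by positivity)]
        simp [sq, mul_assoc]

end PairHitCount

/-! ### Arcs on a circle -/

section Circle

theorem exists_coe_eq_abs_eq_norm {L : ℝ} (z : AddCircle L) :
    ∃ x : ℝ, (x : AddCircle L) = z ∧ |x| = ‖z‖ := by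
  obtain ⟨x, rfl⟩ := QuotientAddGroup.mk_surjective z
  refine ⟨x - round (L⁻¹ * x) * L, ?_, (AddCircle.norm_eq L).symm⟩
  rw [AddCircle.coe_sub]
  have : ((round (L⁻¹ * x) * L : ℝ) : AddCircle L) = 0 :=
    (AddCircle.coe_eq_zero_iff L).2 ⟨round (L⁻¹ * x), by simp⟩
  rw [this, sub_zero]

variable {L : ℝ} [hL : Fact (0 < L)]

theorem norm_coe_le_abs (x : ℝ) : ‖(x : AddCircle L)‖ ≤ |x| := by
  rw [AddCircle.norm_eq]
  have h := round_le (L⁻¹ * x) 0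
  have hL0 := hL.out
  have h2 : |L⁻¹ * x - round (L⁻¹ * x)| * L ≤ |L⁻¹ * x - (0 : ℤ)| * L := by gcongr
  rw [← abs_of_pos hL0, ← abs_mul, ← abs_mul, abs_of_pos hL0] at h2
  have h3 : (L⁻¹ * x - round (L⁻¹ * x)) * L = x - round (L⁻¹ * x) * L := by field_simp
  have h4 : (L⁻¹ * x - (0 : ℤ)) * L = x := by
    push_cast
    field_simp
    ring
  rwa [h3, h4] at h2

theorem lt_norm_coe {p x : ℝ} (h1 : p < x) (h2 : x < L - p) (hp : 0 ≤ p) :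
    p < ‖(x : AddCircle L)‖ := by
  have hL0 := hL.out
  rcases le_total x (L / 2) with h | h
  · rw [(AddCircle.norm_coe_eq_abs_iff L hL0.ne').2
      (by rw [abs_of_pos hL0, abs_of_pos (by linarith)]; exact h)]
    exact h1.trans_le (le_abs_self x)
  · have h3 : (x : AddCircle L) = ((x - L : ℝ) : AddCircle L) := by
      rw [AddCircle.coe_sub, AddCircle.coe_period, sub_zero]
    rw [h3, (AddCircle.norm_coe_eq_abs_iff L hL0.ne').2
      (by rw [abs_of_pos hL0, abs_le]; constructor <;> linarith), lt_abs]
    right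
    linarith

theorem ofReal_le_volume_of_Ioo {A : Set (AddCircle L)} (hA : MeasurableSet A) {x y : ℝ}
    (hxy : y ≤ x + L) (h : ∀ t ∈ Set.Ioo x y, (t : AddCircle L) ∈ A) :
    ENNReal.ofReal (y - x) ≤ volume A := by
  rw [← (AddCircle.measurePreserving_mk L x).measure_preimage hA.nullMeasurableSet,
    ← Real.volume_Ioo, Measure.restrict_apply' measurableSet_Ioc]
  refine measure_mono fun t ht => ⟨h t ht, ht.1, ht.2.le.trans hxy⟩

/-- The end of the longer arc that points away from `v` is missed by the arc around `v`; `√P < L/4`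
prevents that arc from coming round the other side. Squared radii are used because a slice of a disc
at a given height may be empty, which corresponds to `Q < 0`. -/
theorem ofReal_le_volume_arc_diff {u v : AddCircle L} {P Q m : ℝ} (hm : 0 ≤ m) (hmP : m ^ 2 ≤ P)
    (hPL : P < (L / 4) ^ 2) (hQP : Q ≤ P) :
    ENNReal.ofReal (min ‖u - v‖ (2 * m)) ≤
      volume {w : AddCircle L | ‖u - w‖ ^ 2 ≤ P ∧ ¬ ‖v - w‖ ^ 2 ≤ Q} := by
  have hL0 := hL.out
  have hA : MeasurableSet {w : AddCircle L | ‖u - w‖ ^ 2 ≤ P ∧ ¬ ‖v - w‖ ^ 2 ≤ Q} :=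
    (measurableSet_le (f := fun w => ‖u - w‖ ^ 2) (g := fun _ => P) (by fun_prop) (by fun_prop)).inter
      (measurableSet_le (f := fun w => ‖v - w‖ ^ 2) (g := fun _ => Q) (by fun_prop)
        (by fun_prop)).compl
  obtain ⟨a, rfl⟩ := QuotientAddGroup.mk_surjective u
  obtain ⟨h, hh, hnorm⟩ := exists_coe_eq_abs_eq_norm (v - (a : AddCircle L))
  have hv : v = ((a + h : ℝ) : AddCircle L) := by
    rw [AddCircle.coe_add, hh]
    abel
  have hhL : |h| ≤ L / 2 := by
    rw [hnorm]
    simpa [abs_of_pos hL0] using AddCircle.norm_le_half_period L hL0.ne'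
  have hP0 : 0 ≤ P := (sq_nonneg m).trans hmP
  have hp : √P < L / 4 := (Real.sqrt_lt' (by linarith)).2 hPL
  have hmp : m ≤ √P := Real.le_sqrt_of_sq_le hmP
  have hp0 := Real.sqrt_nonneg P
  set p := √P with hpdef
  have hPp : P = p ^ 2 := (Real.sq_sqrt hP0).symm
  change ENNReal.ofReal (min ‖(a : AddCircle L) - v‖ (2 * m)) ≤
    volume {w : AddCircle L | ‖(a : AddCircle L) - w‖ ^ 2 ≤ P ∧ ¬ ‖v - w‖ ^ 2 ≤ Q}
  rw [norm_sub_rev, ← hnorm]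
  have key : ∀ t : ℝ, |a - t| ≤ p → (p < a + h - t ∧ a + h - t < L - p) ∨
      (p < -(a + h - t) ∧ -(a + h - t) < L - p) →
      (t : AddCircle L) ∈ {w : AddCircle L | ‖(a : AddCircle L) - w‖ ^ 2 ≤ P ∧
        ¬ ‖v - w‖ ^ 2 ≤ Q} := by
    intro t h1 h2
    refine ⟨?_, ?_⟩
    · rw [hPp, ← AddCircle.coe_sub]
      exact pow_le_pow_left₀ (norm_nonneg _) ((norm_coe_le_abs _).trans h1) 2
    · rw [hv, ← AddCircle.coe_sub, not_le]
      have h3 : p < ‖((a + h - t : ℝ) : AddCircle L)‖ := by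
        rcases h2 with h2 | h2
        · exact lt_norm_coe h2.1 h2.2 hp0
        · rw [← norm_neg, ← AddCircle.coe_neg]
          exact lt_norm_coe h2.1 h2.2 hp0
      nlinarith
  rcases le_total 0 h with h0 | h0
  · rw [abs_of_nonneg h0] at hhL ⊢
    have hmin : min h (2 * m) ≤ h := min_le_left _ _
    have hmin2 : min h (2 * m) ≤ 2 * m := min_le_right _ _
    refine le_of_eq_of_le ?_ (ofReal_le_volume_of_Ioo hA (x := a - p)
      (y := a - p + min h (2 * m)) (by linarith) fun t ht => key t ?_ (Or.inl ⟨?_, ?_⟩))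
    · congr 1
      ring
    · rw [abs_le]
      constructor <;> linarith [ht.1, ht.2]
    · linarith [ht.1, ht.2]
    · linarith [ht.1, ht.2]
  · rw [abs_of_nonpos h0] at hhL ⊢
    have hmin : min (-h) (2 * m) ≤ -h := min_le_left _ _
    have hmin2 : min (-h) (2 * m) ≤ 2 * m := min_le_right _ _
    refine le_of_eq_of_le ?_ (ofReal_le_volume_of_Ioo hA (x := a + p - min (-h) (2 * m))
      (y := a + p) (by linarith) fun t ht => key t ?_ (Or.inr ⟨?_, ?_⟩))
    · congr 1
      ring
    · rw [abs_le]
      constructor <;> linarith [ht.1, ht.2]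
    · linarith [ht.1, ht.2]
    · linarith [ht.1, ht.2]

/-- There is no restriction on `b`, so intervals that wrap around the whole circle are included. -/
theorem coe_mem_image_Icc_iff {a b t : ℝ} :
    (t : AddCircle L) ∈ ((↑) : ℝ → AddCircle L) '' Set.Icc a (a + b) ↔
      dist (t : AddCircle L) ((a + b / 2 : ℝ) : AddCircle L) ≤ b / 2 := by
  rw [dist_eq_norm]
  constructor
  · rintro ⟨s, hs, hst⟩
    rw [← hst, ← AddCircle.coe_sub]
    refine (norm_coe_le_abs _).trans (abs_le.2 ⟨?_, ?_⟩) <;> linarith [hs.1, hs.2]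
  · intro h
    obtain ⟨x, hx, hxn⟩ := exists_coe_eq_abs_eq_norm
      ((t : AddCircle L) - ((a + b / 2 : ℝ) : AddCircle L))
    rw [← hxn, abs_le] at h
    refine ⟨a + b / 2 + x, ⟨by linarith, by linarith⟩, ?_⟩
    rw [AddCircle.coe_add, hx]
    abel

end Circle

/-! ### Area of the symmetric difference of two discs -/

section TorusGeometry

/-- The torus of side `L` with the metric inherited from the sup metric of the plane. -/
abbrev SupTorus (L : ℝ) : Type := AddCircle L × AddCircle L

/-- The squared Euclidean distance on the torus. -/
noncomputable def sqDist {L : ℝ} (u v : SupTorus L) : ℝ := ‖u.1 - v.1‖ ^ 2 + ‖u.2 - v.2‖ ^ 2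

/-- The triples `((u, v), w)` for which `w` lies in exactly one of the discs of radius `r` around
`u` and `v`. -/
def discSymmDiff (L r : ℝ) : Set ((SupTorus L × SupTorus L) × SupTorus L) :=
  {q | (sqDist q.1.1 q.2 ≤ r ^ 2 ∧ ¬ sqDist q.1.2 q.2 ≤ r ^ 2) ∨
    (sqDist q.1.2 q.2 ≤ r ^ 2 ∧ ¬ sqDist q.1.1 q.2 ≤ r ^ 2)}

theorem continuous_sqDist {L : ℝ} :
    Continuous fun q : SupTorus L × SupTorus L => sqDist q.1 q.2 := by
  unfold sqDist
  fun_prop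

theorem sqDist_comm {L : ℝ} (u v : SupTorus L) : sqDist u v = sqDist v u := by
  simp only [sqDist]
  rw [norm_sub_rev, norm_sub_rev u.2]

theorem dist_le_of_sqDist_le {L : ℝ} {u v : SupTorus L} {r : ℝ} (hr : 0 ≤ r)
    (h : sqDist u v ≤ r ^ 2) : dist u v ≤ r := by
  unfold sqDist at h
  rw [Prod.dist_eq, dist_eq_norm, dist_eq_norm]
  refine max_le (abs_le_of_sq_le_sq' ?_ hr).2 (abs_le_of_sq_le_sq' ?_ hr).2 <;>
  nlinarith [sq_nonneg ‖u.1 - v.1‖, sq_nonneg ‖u.2 - v.2‖]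

theorem measurableSet_discSymmDiff {L : ℝ} (r : ℝ) : MeasurableSet (discSymmDiff L r) := by
  have : OpensMeasurableSpace (SupTorus L × SupTorus L) := inferInstance
  have : OpensMeasurableSpace ((SupTorus L × SupTorus L) × SupTorus L) :=
    Prod.opensMeasurableSpace
  have h1 : MeasurableSet {q : (SupTorus L × SupTorus L) × SupTorus L |
      sqDist q.1.1 q.2 ≤ r ^ 2} :=
    (isClosed_le (continuous_sqDist.comp (f := fun q : (SupTorus L × SupTorus L) × SupTorus L =>
      (q.1.1, q.2)) (by fun_prop)) continuous_const).measurableSet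
  have h2 : MeasurableSet {q : (SupTorus L × SupTorus L) × SupTorus L |
      sqDist q.1.2 q.2 ≤ r ^ 2} :=
    (isClosed_le (continuous_sqDist.comp (f := fun q : (SupTorus L × SupTorus L) × SupTorus L =>
      (q.1.2, q.2)) (by fun_prop)) continuous_const).measurableSet
  exact (h1.inter h2.compl).union (h2.inter h1.compl)

variable {L : ℝ} [hL : Fact (0 < L)]

theorem volume_closedBall_le (c : SupTorus L) {ρ : ℝ} (hρ : 0 ≤ ρ) :
    volume (Metric.closedBall c ρ) ≤ ENNReal.ofReal (4 * ρ ^ 2) := by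
  rw [← Prod.mk.eta (p := c), ← closedBall_prod_same, Measure.volume_eq_prod, Measure.prod_prod,
    AddCircle.volume_closedBall, AddCircle.volume_closedBall,
    ← ENNReal.ofReal_mul (le_min hL.out.le (by positivity))]
  refine ENNReal.ofReal_le_ofReal ?_
  have h1 : min L (2 * ρ) ≤ 2 * ρ := min_le_right _ _
  have h2 : 0 ≤ min L (2 * ρ) := le_min hL.out.le (by positivity)
  nlinarith

/-- At height `z` both discs cut out arcs, and the one around `u` has squared half-length at least
`3 r^2 / 4`. The longer of the two is therefore at least as long, and the arc estimate applies to it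
with `m = r / 2`. -/
theorem ofReal_le_volume_section (u v : SupTorus L) {r : ℝ} (hr : 0 ≤ r) (hrL : r < L / 4)
    {z : AddCircle L} (hz : ‖u.2 - z‖ ≤ r / 2) :
    ENNReal.ofReal (min ‖u.1 - v.1‖ r) ≤
      volume ((fun x => (x, z)) ⁻¹' (Prod.mk (u, v) ⁻¹' discSymmDiff L r)) := by
  have hsq : ‖u.2 - z‖ ^ 2 ≤ (r / 2) ^ 2 := pow_le_pow_left₀ (norm_nonneg _) hz 2
  have hrL2 : r ^ 2 < (L / 4) ^ 2 := pow_lt_pow_left₀ hrL hr two_ne_zero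
  rcases le_total (r ^ 2 - ‖v.2 - z‖ ^ 2) (r ^ 2 - ‖u.2 - z‖ ^ 2) with h | h
  · have h1 := ofReal_le_volume_arc_diff (u := u.1) (v := v.1) (m := r / 2) (by positivity)
      (P := r ^ 2 - ‖u.2 - z‖ ^ 2) (by nlinarith) (by nlinarith [sq_nonneg ‖u.2 - z‖]) h
    rw [mul_div_cancel₀ r two_ne_zero] at h1
    refine h1.trans (measure_mono fun x hx => Or.inl ⟨?_, fun h2 => hx.2 ?_⟩)
    · have := hx.1
      simp only [sqDist]
      linarith
    · simp only [sqDist] at h2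
      linarith
  · have h1 := ofReal_le_volume_arc_diff (u := v.1) (v := u.1) (m := r / 2) (by positivity)
      (P := r ^ 2 - ‖v.2 - z‖ ^ 2) (by nlinarith) (by nlinarith [sq_nonneg ‖v.2 - z‖]) h
    rw [mul_div_cancel₀ r two_ne_zero, norm_sub_rev] at h1
    refine h1.trans (measure_mono fun x hx => Or.inr ⟨?_, fun h2 => hx.2 ?_⟩)
    · have := hx.1
      simp only [sqDist]
      linarith
    · simp only [sqDist] at h2
      linarith

theorem ofReal_le_volume_of_fst (u v : SupTorus L) {r : ℝ} (hr : 0 ≤ r) (hrL : r < L / 4) :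
    ENNReal.ofReal (r * min ‖u.1 - v.1‖ r) ≤ volume (Prod.mk (u, v) ⁻¹' discSymmDiff L r) := by
  have hL0 := hL.out
  rw [Measure.volume_eq_prod, Measure.prod_apply_symm
    ((measurableSet_discSymmDiff r).preimage measurable_prodMk_left)]
  calc ENNReal.ofReal (r * min ‖u.1 - v.1‖ r)
      = ∫⁻ z, (Metric.closedBall u.2 (r / 2)).indicator
          (fun _ => ENNReal.ofReal (min ‖u.1 - v.1‖ r)) z := by
        rw [lintegral_indicator_const Metric.isClosed_closedBall.measurableSet,
          AddCircle.volume_closedBall, mul_div_cancel₀ r two_ne_zero,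
          min_eq_right (a := L) (by linarith), mul_comm r, ENNReal.ofReal_mul (by positivity)]
    _ ≤ _ := by
        refine lintegral_mono fun z => ?_
        refine Set.indicator_apply_le' (fun hz => ?_) fun _ => zero_le
        refine ofReal_le_volume_section u v hr hrL ?_
        rwa [Metric.mem_closedBall', dist_eq_norm] at hz

theorem ofReal_le_volume_discSymmDiff (u v : SupTorus L) {r : ℝ} (hr : 0 ≤ r)
    (hrL : r < L / 4) :
    ENNReal.ofReal (r * min (dist u v) r) ≤ volume (Prod.mk (u, v) ⁻¹' discSymmDiff L r) := by
  rw [Prod.dist_eq, dist_eq_norm, dist_eq_norm]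
  rcases le_total ‖u.2 - v.2‖ ‖u.1 - v.1‖ with h | h
  · rw [max_eq_left h]
    exact ofReal_le_volume_of_fst u v hr hrL
  · rw [max_eq_right h]
    -- When the second coordinate realises the sup distance, reflect in the diagonal.
    refine (ofReal_le_volume_of_fst u.swap v.swap hr hrL).trans_eq ?_
    have hmeas : MeasurableSet (Prod.mk (u.swap, v.swap) ⁻¹' discSymmDiff L r) :=
      (measurableSet_discSymmDiff r).preimage measurable_prodMk_left
    have hsw := (Measure.measurePreserving_swap (μ := (volume : Measure (AddCircle L)))
      (ν := (volume : Measure (AddCircle L)))).measure_preimage hmeas.nullMeasurableSet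
    rw [Measure.volume_eq_prod, ← hsw]
    congr 1
    ext w
    simp [discSymmDiff, sqDist, add_comm]

end TorusGeometry

/-! ### The uniform law on the torus -/

section UniformTorus

variable {n : ℕ}

/-- The quotient map from the plane to the torus of side `√n`. -/
noncomputable def toSupTorus (n : ℕ) (p : ℝ × ℝ) : SupTorus √(n : ℝ) :=
  ((p.1 : AddCircle √(n : ℝ)), (p.2 : AddCircle √(n : ℝ)))

theorem torusDist_le_iff {p q : ℝ × ℝ} {r : ℝ} (hr : 0 ≤ r) :
    torusDist √(n : ℝ) p q ≤ r ↔ sqDist (toSupTorus n p) (toSupTorus n q) ≤ r ^ 2 := by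
  rw [torusDist, WithLp.prod_dist_eq_of_L2, Real.sqrt_le_left hr]
  simp only [toTorus, sqDist, toSupTorus, dist_eq_norm, WithLp.toLp_fst, WithLp.toLp_snd]

variable [hL : Fact (0 < √(n : ℝ))]

/-- The uniform probability distribution on the torus of side `√n`. -/
noncomputable def torusLaw (n : ℕ) [Fact (0 < √(n : ℝ))] : Measure (SupTorus √(n : ℝ)) :=
  (n : ENNReal)⁻¹ • volume

theorem measurePreserving_toSupTorus :
    MeasurePreserving (toSupTorus n) (uniformSquare n) (torusLaw n) := by
  have h1 := AddCircle.measurePreserving_mk √(n : ℝ) 0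
  rw [zero_add, Measure.restrict_congr_set Ioc_ae_eq_Icc] at h1
  have h2 := (h1.prod h1).smul_measure ((n : ENNReal)⁻¹)
  have h3 : uniformSquare n = (n : ENNReal)⁻¹ •
      ((volume.restrict (Set.Icc 0 √(n : ℝ))).prod (volume.restrict (Set.Icc 0 √(n : ℝ)))) := by
    rw [uniformSquare, ProbabilityTheory.cond, Measure.prod_restrict, ← Measure.volume_eq_prod]
    congr 2
    rw [Measure.volume_eq_prod, Measure.prod_prod, Real.volume_Icc, sub_zero,
      ← ENNReal.ofReal_mul (Real.sqrt_nonneg _), Real.mul_self_sqrt (Nat.cast_nonneg n),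
      ENNReal.ofReal_natCast]
  rw [h3]
  exact h2

instance : IsProbabilityMeasure (torusLaw n) := by
  refine ⟨?_⟩
  have hn : (n : ENNReal) ≠ 0 := by
    have := Real.sqrt_pos.1 hL.out
    exact_mod_cast this.ne'
  rw [torusLaw, Measure.smul_apply, Measure.volume_eq_prod, ← Set.univ_prod_univ,
    Measure.prod_prod, AddCircle.measure_univ, ← ENNReal.ofReal_mul (Real.sqrt_nonneg _),
    Real.mul_self_sqrt (Nat.cast_nonneg n), ENNReal.ofReal_natCast, smul_eq_mul]
  exact ENNReal.inv_mul_cancel hn (ENNReal.natCast_ne_top n)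

instance : IsProbabilityMeasure (uniformSquare n) :=
  ⟨by
    have h := (measurePreserving_toSupTorus (n := n)).measure_preimage nullMeasurableSet_univ
    rwa [Set.preimage_univ, measure_univ (μ := torusLaw n)] at h⟩

theorem measurePreserving_toSupTorus_pi :
    MeasurePreserving (fun (x : Fin n → ℝ × ℝ) i => toSupTorus n (x i)) (pointsLaw n)
      (Measure.pi fun _ => torusLaw n) :=
  measurePreserving_pi _ _ fun _ => measurePreserving_toSupTorus

theorem torusLaw_closedBall_le (c : SupTorus √(n : ℝ)) {ρ : ℝ} (hρ : 0 ≤ ρ) :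
    torusLaw n (Metric.closedBall c ρ) ≤ ENNReal.ofReal (4 * ρ ^ 2 / n) := by
  have hn : (0 : ℝ) < n := Real.sqrt_pos.1 hL.out
  rw [torusLaw, Measure.smul_apply, smul_eq_mul, div_eq_inv_mul,
    ENNReal.ofReal_mul (by positivity), ENNReal.ofReal_inv_of_pos hn, ENNReal.ofReal_natCast]
  gcongr
  exact volume_closedBall_le c hρ

theorem le_torusLaw_discSymmDiff (u v : SupTorus √(n : ℝ)) {r : ℝ} (hr : 0 ≤ r)
    (hrL : r < √(n : ℝ) / 4) :
    r * min (dist u v) r ≤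
      n * (torusLaw n).real (Prod.mk (u, v) ⁻¹' discSymmDiff √(n : ℝ) r) := by
  have hn : (0 : ℝ) < n := Real.sqrt_pos.1 hL.out
  rw [← div_le_iff₀' hn, measureReal_def,
    ← ENNReal.ofReal_le_iff_le_toReal (measure_ne_top _ _), torusLaw,
    Measure.smul_apply, smul_eq_mul, div_eq_inv_mul,
    ENNReal.ofReal_mul (by positivity), ENNReal.ofReal_inv_of_pos hn, ENNReal.ofReal_natCast]
  gcongr
  exact ofReal_le_volume_discSymmDiff u v hr hrL

/-- In the sup metric squares are closed balls, wrap-around included. This is why `SupTorus` carries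
the sup metric while adjacency goes through `sqDist`. -/
theorem mem_verticesIn_iff {x : Fin n → ℝ × ℝ} {S : Square} {i : Fin n} :
    i ∈ verticesIn x S ↔ toSupTorus n (x i) ∈ Metric.closedBall
      (toSupTorus n (S.corner.1 + S.side / 2, S.corner.2 + S.side / 2)) (S.side / 2) := by
  rw [Metric.mem_closedBall, Prod.dist_eq, max_le_iff]
  simp only [toSupTorus]
  rw [← coe_mem_image_Icc_iff, ← coe_mem_image_Icc_iff]
  constructor
  · rintro ⟨p, hp, h⟩
    have h' := congrArg WithLp.ofLp h
    exact ⟨⟨p.1, hp.1, congrArg Prod.fst h'⟩, ⟨p.2, hp.2, congrArg Prod.snd h'⟩⟩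
  · rintro ⟨⟨a, ha, ha'⟩, ⟨b, hb, hb'⟩⟩
    refine ⟨(a, b), ⟨ha, hb⟩, ?_⟩
    simp [toTorus, ha', hb']

end UniformTorus

/-! ### Random subsets and alteration -/

section Alteration

variable {ι E : Type*} [DecidableEq ι]

/-- The weights are the law of a random subset of `V` with independent inclusions of probability
`p`; the sum is the probability of missing `A`. -/
theorem sum_powerset_disjoint_weight (V A : Finset ι) (hA : A ⊆ V) (p : ℝ) :
    ∑ W ∈ V.powerset with Disjoint A W, p ^ W.card * (1 - p) ^ (V.card - W.card) =
      (1 - p) ^ A.card := by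
  have h1 : V.powerset.filter (fun W => Disjoint A W) = (V \ A).powerset := by
    ext W
    simp only [Finset.mem_filter, Finset.mem_powerset, Finset.subset_sdiff]
    rw [disjoint_comm]
  have h2 : ∀ W ∈ (V \ A).powerset, p ^ W.card * (1 - p) ^ (V.card - W.card) =
      (1 - p) ^ A.card * (p ^ W.card * (1 - p) ^ ((V \ A).card - W.card)) := by
    intro W hW
    have h3 := Finset.card_le_card (Finset.mem_powerset.1 hW)
    have h4 := Finset.card_sdiff_add_card_eq_card hA
    rw [show V.card - W.card = A.card + ((V \ A).card - W.card) by omega, pow_add]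
    ring
  rw [h1, Finset.sum_congr rfl h2, ← Finset.mul_sum, Finset.sum_pow_mul_eq_add_pow]
  simp

/-- Alteration: a random subset of `V` of density `p` leaves few of the sets `Δ e` unhit. -/
theorem exists_subset_card_add_card_unhit_le (V : Finset ι) (F : Finset E) (Δ : E → Finset ι)
    (hΔ : ∀ e ∈ F, Δ e ⊆ V) {p : ℝ} (hp0 : 0 ≤ p) (hp1 : p ≤ 1) :
    ∃ W ⊆ V, (W.card : ℝ) + (F.filter fun e => Disjoint (Δ e) W).card ≤
      p * V.card + ∑ e ∈ F, (1 - p) ^ (Δ e).card := by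
  let wt : Finset ι → ℝ := fun W => p ^ W.card * (1 - p) ^ (V.card - W.card)
  let X : Finset ι → ℝ := fun W => (W.card : ℝ) + (F.filter fun e => Disjoint (Δ e) W).card
  have hwt : ∀ W, 0 ≤ wt W := fun W =>
    mul_nonneg (pow_nonneg hp0 _) (pow_nonneg (by linarith) _)
  have hone : ∑ W ∈ V.powerset, wt W = 1 := by
    simp only [wt]
    rw [Finset.sum_pow_mul_eq_add_pow]
    simp
  -- A minimiser is at most the weighted average, so expectations become finite sums.
  obtain ⟨W₀, hW₀, hmin⟩ := Finset.exists_min_image V.powerset X ⟨∅, by simp⟩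
  refine ⟨W₀, Finset.mem_powerset.1 hW₀, ?_⟩
  have hcard : ∑ W ∈ V.powerset, wt W * (W.card : ℝ) = p * V.card := by
    have h1 : ∀ W ∈ V.powerset, wt W * (W.card : ℝ) =
        ∑ v ∈ V, (wt W - if Disjoint {v} W then wt W else 0) := by
      intro W hW
      have h2 : ∀ v ∈ V, (wt W - if Disjoint {v} W then wt W else 0) =
          if v ∈ W then wt W else 0 := by
        intro v _
        by_cases hv : v ∈ W <;> simp [hv]
      rw [Finset.sum_congr rfl h2, ← Finset.sum_filter, Finset.sum_const, nsmul_eq_mul, mul_comm,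
        Finset.filter_mem_eq_inter, Finset.inter_eq_right.2 (Finset.mem_powerset.1 hW)]
    rw [Finset.sum_congr rfl h1, Finset.sum_comm]
    have h3 : ∀ v ∈ V, ∑ W ∈ V.powerset, (wt W - if Disjoint {v} W then wt W else 0) = p := by
      intro v hv
      rw [Finset.sum_sub_distrib, hone, ← Finset.sum_filter,
        sum_powerset_disjoint_weight V {v} (by simpa using hv)]
      simp
    rw [Finset.sum_congr rfl h3, Finset.sum_const, nsmul_eq_mul, mul_comm]
  have hunhit : ∑ W ∈ V.powerset, wt W * ((F.filter fun e => Disjoint (Δ e) W).card : ℝ) =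
      ∑ e ∈ F, (1 - p) ^ (Δ e).card := by
    have h1 : ∀ W ∈ V.powerset, wt W * ((F.filter fun e => Disjoint (Δ e) W).card : ℝ) =
        ∑ e ∈ F, if Disjoint (Δ e) W then wt W else 0 := by
      intro W _
      rw [← Finset.sum_filter, Finset.sum_const, nsmul_eq_mul, mul_comm]
    rw [Finset.sum_congr rfl h1, Finset.sum_comm]
    refine Finset.sum_congr rfl fun e he => ?_
    rw [← Finset.sum_filter]
    exact sum_powerset_disjoint_weight V (Δ e) (hΔ e he) p
  calc X W₀ = ∑ W ∈ V.powerset, wt W * X W₀ := by rw [← Finset.sum_mul, hone, one_mul]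
    _ ≤ ∑ W ∈ V.powerset, wt W * X W :=
        Finset.sum_le_sum fun W hW => mul_le_mul_of_nonneg_left (hmin W hW) (hwt W)
    _ = _ := by
        simp only [X, mul_add]
        rw [Finset.sum_add_distrib, hcard, hunhit]

end Alteration

/-! ### Maximal packings as covers -/

section Covers

variable {ι : Type*} [DecidableEq ι]

/-- Either there are `m` disjoint stars, or few vertices meet all stars. -/
theorem exists_starPacking_or_cover (P : ι → Prop) (Q : ι → ι → Prop) (s m : ℕ) :
    (∃ (C : Finset ι) (g : ι → Fin s → ι), C.card = m ∧ IsStarPacking P Q C g) ∨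
      ∃ U : Finset ι, U.card ≤ (s + 1) * m ∧ ∀ (c : ι) (v : Fin s → ι), P c →
        (∀ b, Q c (v b)) → Function.Injective (fun o : Option (Fin s) => o.elim c v) →
        c ∈ U ∨ ∃ b, v b ∈ U := by
  induction m with
  | zero =>
    refine Or.inl ⟨∅, fun i _ => i, rfl, ⟨?_, by simp, by simp⟩⟩
    intro p hp
    simp at hp
  | succ m ih =>
    rcases ih with ⟨C, g, hC, h⟩ | ⟨U, hU, h⟩
    swap
    · exact Or.inr ⟨U, hU.trans (by gcongr; omega), h⟩
    let U : Finset ι := (C ×ˢ (Finset.univ : Finset (Option (Fin s)))).image (starVertex g)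
    have hUcard : U.card ≤ (s + 1) * m := by
      refine Finset.card_image_le.trans ?_
      rw [Finset.card_product, hC, Finset.card_univ, Fintype.card_option, Fintype.card_fin,
        mul_comm]
    have hUmem : ∀ c ∈ C, ∀ o, starVertex g (c, o) ∈ U := fun c hc o =>
      Finset.mem_image_of_mem _ (Finset.mem_product.2 ⟨hc, Finset.mem_univ _⟩)
    -- Either the `(s + 1) m` vertices of the packing meet every star, or a star that avoids them
    -- extends it.
    by_cases hcov : ∀ (c : ι) (v : Fin s → ι), P c → (∀ b, Q c (v b)) →
        Function.Injective (fun o : Option (Fin s) => o.elim c v) → c ∈ U ∨ ∃ b, v b ∈ U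
    · exact Or.inr ⟨U, hUcard.trans (by gcongr; omega), hcov⟩
    push Not at hcov
    obtain ⟨c, v, hPc, hQ, hinj, hcU, hvU⟩ := hcov
    have hcC : c ∉ C := fun hc => hcU (hUmem c hc none)
    have hne : ∀ d ∈ C, d ≠ c := fun d hd h => hcC (h ▸ hd)
    have hnew : ∀ o, starVertex (Function.update g c v) (c, o) = o.elim c v := by
      intro o
      simp [starVertex]
    have hold : ∀ d ∈ C, ∀ o, starVertex (Function.update g c v) (d, o) = starVertex g (d, o) := by
      intro d hd o
      simp [starVertex, Function.update_of_ne (hne d hd)]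
    have houtside : ∀ o : Option (Fin s), o.elim c v ∉ U := by
      rintro (_ | b)
      · exact hcU
      · exact hvU b
    refine Or.inl ⟨insert c C, Function.update g c v,
      by rw [Finset.card_insert_of_notMem hcC, hC], ⟨?_, ?_, ?_⟩⟩
    · rintro ⟨d, o⟩ hd ⟨d', o'⟩ hd' heq
      rcases Finset.mem_insert.1 hd with hdc | hdC <;>
        rcases Finset.mem_insert.1 hd' with hdc' | hdC'
      · simp only at hdc hdc'
        subst hdc
        subst hdc'
        rw [hnew, hnew] at heq
        rw [hinj heq]
      · simp only at hdc
        subst hdc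
        rw [hnew, hold d' hdC'] at heq
        exact absurd (heq ▸ hUmem d' hdC' o') (houtside o)
      · simp only at hdc'
        subst hdc'
        rw [hnew, hold d hdC] at heq
        exact absurd (heq ▸ hUmem d hdC o) (houtside o')
      · rw [hold d hdC, hold d' hdC'] at heq
        exact h.injOn hdC hdC' heq
    · intro d hd
      rcases Finset.mem_insert.1 hd with rfl | hd
      exacts [hPc, h.center d hd]
    · intro d hd b
      rcases Finset.mem_insert.1 hd with rfl | hd
      · simpa using hQ b
      · simpa [Function.update_of_ne (hne d hd)] using h.leaf d hd b

/-- Vertex disjoint edges form a packing of stars with one leaf. -/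
theorem exists_starPacking_of_edges {P : ι → Prop} {Q : ι → ι → Prop} (F : Finset (ι × ι))
    (hne : ∀ q ∈ F, q.1 ≠ q.2) (hP : ∀ q ∈ F, P q.1) (hQ : ∀ q ∈ F, Q q.1 q.2)
    (hdisj : ∀ q ∈ F, ∀ q' ∈ F, q ≠ q' →
      q.1 ≠ q'.1 ∧ q.1 ≠ q'.2 ∧ q.2 ≠ q'.1 ∧ q.2 ≠ q'.2) :
    ∃ (C : Finset ι) (g : ι → Fin 1 → ι), C.card = F.card ∧ IsStarPacking P Q C g := by
  classical
  have hex : ∀ c : ι, ∃ d : ι, c ∈ F.image Prod.fst → (c, d) ∈ F := by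
    intro c
    by_cases hc : c ∈ F.image Prod.fst
    · obtain ⟨q, hq, rfl⟩ := Finset.mem_image.1 hc
      exact ⟨q.2, fun _ => hq⟩
    · exact ⟨c, fun h => absurd h hc⟩
  choose d hd using hex
  refine ⟨F.image Prod.fst, fun c _ => d c, Finset.card_image_of_injOn ?_, ⟨?_, ?_, ?_⟩⟩
  · intro q hq q' hq' h
    by_contra hqq
    exact (hdisj q hq q' hq' hqq).1 h
  · rintro ⟨c, o⟩ hc ⟨c', o'⟩ hc' heq
    have h1 := hd c hc
    have h2 := hd c' hc'
    have hcc : c = c' := by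
      by_contra hcc
      have h3 := hdisj _ h1 _ h2 (fun h => hcc (congrArg Prod.fst h))
      rcases o with _ | b <;> rcases o' with _ | b' <;> simp only [starVertex, Option.elim] at heq
      exacts [h3.1 heq, h3.2.1 heq, h3.2.2.1 heq, h3.2.2.2 heq]
    subst hcc
    have h4 := hne _ h1
    rcases o with _ | b <;> rcases o' with _ | b' <;> simp only [starVertex, Option.elim] at heq
    · rfl
    · exact absurd heq h4
    · exact absurd heq.symm h4
    · rw [Subsingleton.elim b b']
  · intro c hc
    exact hP _ (hd c hc)
  · intro c hc b
    exact hQ _ (hd c hc)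

end Covers

/-! ### Deterministic construction of the sensor set -/

section Resolving

variable {n : ℕ} {X : Type*} [PseudoMetricSpace X]

/-- By `hdeg` the near pairs form a matching, so `hmatch` bounds the number of those within `(k + 1)
δ` by `4^k m`. Charging `8^{-k}` to each and summing over `k ≥ 1` gives at most `m`; scale `0` is
empty by `hsep`. -/
theorem sum_near_pairs_le {V A : Finset (Fin n)} (hAV : A ⊆ V) (y : Fin n → X)
    {δ : ℝ} (hδ : 0 < δ) {K m : ℕ} (f : Fin n → Fin n → ℝ)
    (hmatch : ∀ k, 1 ≤ k → k < K → ¬ ∃ (C : Finset (Fin n)) (g : Fin n → Fin 1 → Fin n),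
      C.card = 4 ^ k * m ∧ IsStarPacking (· ∈ V) (fun i j => dist (y i) (y j) ≤ (k + 1) * δ) C g)
    (hsep : ∀ i ∈ A, ∀ j ∈ A, i ≠ j → δ < dist (y i) (y j))
    (hdeg : ∀ i ∈ A, ∀ j ∈ A, ∀ k ∈ A, i ≠ j → i ≠ k → j ≠ k →
      dist (y i) (y j) ≤ K * δ → ¬ dist (y i) (y k) ≤ K * δ)
    (hf : ∀ i ∈ A, ∀ j ∈ A, i ≠ j → ∀ k : ℕ, 1 ≤ k → k < K → k * δ < dist (y i) (y j) →
      f i j ≤ (1 / 8) ^ k) :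
    ∑ q ∈ A ×ˢ A with q.1 < q.2 ∧ dist (y q.1) (y q.2) ≤ K * δ, f q.1 q.2 ≤ m := by
  classical
  set F : Finset (Fin n × Fin n) :=
    (A ×ˢ A).filter fun q => q.1 < q.2 ∧ dist (y q.1) (y q.2) ≤ K * δ with hF
  have hFmem : ∀ q ∈ F, q.1 ∈ A ∧ q.2 ∈ A ∧ q.1 < q.2 ∧ dist (y q.1) (y q.2) ≤ K * δ := by
    intro q hq
    simp only [hF, Finset.mem_filter, Finset.mem_product] at hq
    exact ⟨hq.1.1, hq.1.2, hq.2⟩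
  have hdisj : ∀ q ∈ F, ∀ q' ∈ F, q ≠ q' →
      q.1 ≠ q'.1 ∧ q.1 ≠ q'.2 ∧ q.2 ≠ q'.1 ∧ q.2 ≠ q'.2 := by
    rintro ⟨a, b⟩ hq ⟨a', b'⟩ hq' hqq
    obtain ⟨ha, hb, hab, hd⟩ := hFmem _ hq
    obtain ⟨ha', hb', hab', hd'⟩ := hFmem _ hq'
    simp only at ha hb hab hd ha' hb' hab' hd' ⊢
    refine ⟨?_, ?_, ?_, ?_⟩ <;> rintro rfl
    · exact hdeg a ha b hb b' hb' hab.ne hab'.ne (fun h => hqq (by rw [h])) hd hd'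
    · rw [dist_comm] at hd'
      exact hdeg a ha b hb a' ha' hab.ne hab'.ne' (hab'.trans hab).ne' hd hd'
    · rw [dist_comm] at hd
      exact hdeg b hb a ha b' hb' hab.ne' hab'.ne (hab.trans hab').ne hd hd'
    · rw [dist_comm] at hd hd'
      exact hdeg b hb a ha a' ha' hab.ne' hab'.ne' (fun h => hqq (by rw [h])) hd hd'
  have hcount : ∀ k ∈ Finset.Ico 1 K,
      ((F.filter fun q => dist (y q.1) (y q.2) ≤ (k + 1) * δ).card : ℝ) ≤ 4 ^ k * m := by
    intro k hk
    obtain ⟨hk1, hkK⟩ := Finset.mem_Ico.1 hk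
    by_contra hlt
    have hlt' : 4 ^ k * m ≤ (F.filter fun q => dist (y q.1) (y q.2) ≤ (k + 1) * δ).card := by
      have := (not_le.1 hlt).le
      exact_mod_cast this
    obtain ⟨F', hF', hcard⟩ := Finset.exists_subset_card_eq hlt'
    have hF'F : ∀ q ∈ F', q ∈ F := fun q hq => (Finset.mem_filter.1 (hF' hq)).1
    obtain ⟨C, g, hC, hpack⟩ := exists_starPacking_of_edges (P := (· ∈ V))
      (Q := fun i j => dist (y i) (y j) ≤ (k + 1) * δ) F'
      (fun q hq => (hFmem q (hF'F q hq)).2.2.1.ne) (fun q hq => hAV (hFmem q (hF'F q hq)).1)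
      (fun q hq => (Finset.mem_filter.1 (hF' hq)).2)
      (fun q hq q' hq' => hdisj q (hF'F q hq) q' (hF'F q' hq'))
    exact hmatch k hk1 hkK ⟨C, g, hC.trans hcard, hpack⟩
  have hterm : ∀ q ∈ F, f q.1 q.2 ≤ ∑ k ∈ Finset.Ico 1 K,
      if dist (y q.1) (y q.2) ≤ (k + 1) * δ then (1 / 8 : ℝ) ^ k else 0 := by
    intro q hq
    obtain ⟨ha, hb, hab, hd⟩ := hFmem q hq
    have hlow := hsep _ ha _ hb hab.ne
    -- Rounding up places the distance in the half-open interval `(j δ, (j + 1) δ]`.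
    obtain ⟨j, hj⟩ : ∃ j, ⌈dist (y q.1) (y q.2) / δ⌉₊ = j + 1 :=
      Nat.exists_eq_succ_of_ne_zero (Nat.ceil_pos.2 (by positivity [hδ.trans hlow])).ne'
    have h1 : (j : ℝ) * δ < dist (y q.1) (y q.2) := by
      rw [← lt_div_iff₀ hδ]
      exact Nat.lt_ceil.1 (by omega)
    have h2 : dist (y q.1) (y q.2) ≤ (j + 1) * δ := by
      rw [← div_le_iff₀ hδ]
      have := Nat.le_ceil (dist (y q.1) (y q.2) / δ)
      rw [hj] at this
      exact_mod_cast this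
    have hjK : j < K := by
      have : (j : ℝ) < K := lt_of_mul_lt_mul_right (h1.trans_le hd) hδ.le
      exact_mod_cast this
    have hj1 : 1 ≤ j := by
      by_contra h0
      have : j = 0 := by omega
      subst this
      norm_num at h2
      linarith
    calc f q.1 q.2 ≤ (1 / 8) ^ j := hf _ ha _ hb hab.ne j hj1 hjK h1
      _ = if dist (y q.1) (y q.2) ≤ (j + 1) * δ then (1 / 8 : ℝ) ^ j else 0 := (if_pos h2).symm
      _ ≤ _ := Finset.single_le_sum
          (f := fun k : ℕ => if dist (y q.1) (y q.2) ≤ (k + 1) * δ then (1 / 8 : ℝ) ^ k else 0)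
          (fun k _ => by positivity) (Finset.mem_Ico.2 ⟨hj1, hjK⟩)
  have hgeom : ∑ k ∈ Finset.Ico 1 K, (1 / 2 : ℝ) ^ k ≤ 1 := by
    rw [Finset.sum_Ico_eq_sum_range]
    have h1 : ∑ i ∈ Finset.range (K - 1), (1 / 2 : ℝ) ^ (1 + i) =
        1 / 2 * ∑ i ∈ Finset.range (K - 1), (1 / 2 : ℝ) ^ i := by
      rw [Finset.mul_sum]
      exact Finset.sum_congr rfl fun i _ => by rw [pow_add, pow_one]
    rw [h1]
    linarith [sum_geometric_two_le (K - 1)]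
  calc ∑ q ∈ F, f q.1 q.2
      ≤ ∑ q ∈ F, ∑ k ∈ Finset.Ico 1 K,
          if dist (y q.1) (y q.2) ≤ (k + 1) * δ then (1 / 8 : ℝ) ^ k else 0 :=
        Finset.sum_le_sum hterm
    _ = ∑ k ∈ Finset.Ico 1 K,
          ((F.filter fun q => dist (y q.1) (y q.2) ≤ (k + 1) * δ).card : ℝ) * (1 / 8) ^ k := by
        rw [Finset.sum_comm]
        refine Finset.sum_congr rfl fun k _ => ?_
        rw [← Finset.sum_filter, Finset.sum_const, nsmul_eq_mul]
    _ ≤ ∑ k ∈ Finset.Ico 1 K, (m : ℝ) * (1 / 2) ^ k := by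
        refine Finset.sum_le_sum fun k hk => ?_
        calc _ ≤ (4 ^ k * m : ℝ) * (1 / 8) ^ k := by
              gcongr
              exact hcount k hk
          _ = _ := by
              rw [mul_right_comm, ← mul_pow, mul_comm]
              norm_num
    _ ≤ m := by
        rw [← Finset.mul_sum]
        exact mul_le_of_le_one_right (Nat.cast_nonneg m) hgeom

theorem exists_resolving_set {V A : Finset (Fin n)} (hAV : A ⊆ V) (y : Fin n → X)
    (Δ : Fin n → Fin n → Finset (Fin n)) {δ p N : ℝ} (hδ : 0 < δ) (hp0 : 0 ≤ p) (hp1 : p ≤ 1)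
    (hN : 0 < N) {K m m' : ℕ} (hV : (V.card : ℝ) ≤ N)
    (hmatch : ∀ k < K, ¬ ∃ (C : Finset (Fin n)) (g : Fin n → Fin 1 → Fin n),
      C.card = 4 ^ k * m ∧ IsStarPacking (· ∈ V) (fun i j => dist (y i) (y j) ≤ (k + 1) * δ) C g)
    (hK : 1 ≤ K)
    (hcherry : K = 1 ∨ ¬ ∃ (C : Finset (Fin n)) (g : Fin n → Fin 2 → Fin n),
      C.card = m' ∧ IsStarPacking (· ∈ V) (fun i j => dist (y i) (y j) ≤ K * δ) C g)
    (hΔ : ∀ i ∈ A, ∀ j ∈ A, Δ i j ⊆ V)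
    (hnear : ∀ i ∈ A, ∀ j ∈ A, i ≠ j → ∀ k : ℕ, 1 ≤ k → k < K → k * δ < dist (y i) (y j) →
      (1 - p) ^ (Δ i j).card ≤ (1 / 8) ^ k)
    (hfar : ∀ i ∈ A, ∀ j ∈ A, i ≠ j → K * δ < dist (y i) (y j) →
      (1 - p) ^ (Δ i j).card ≤ 1 / N ^ 2) :
    ∃ W ⊆ V, (W.card : ℝ) ≤ p * N + 3 * m + 3 * m' + 1 ∧
      ∀ i ∈ A, ∀ j ∈ A, i < j → i ∈ W ∨ j ∈ W ∨ ¬ Disjoint (Δ i j) W := by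
  classical
  have hinj2 : ∀ i j : Fin n, i ≠ j →
      Function.Injective (fun o : Option (Fin 1) => o.elim i (fun _ => j)) := by
    rintro i j hij (_ | a) (_ | b) h
    · rfl
    · exact absurd h hij
    · exact absurd h.symm hij
    · rw [Subsingleton.elim a b]
  obtain ⟨U₁, hU₁card, hU₁⟩ : ∃ U : Finset (Fin n), U.card ≤ 2 * m ∧ ∀ i ∈ V, ∀ j, i ≠ j →
      dist (y i) (y j) ≤ δ → i ∈ U ∨ j ∈ U := by
    rcases exists_starPacking_or_cover (· ∈ V) (fun i j : Fin n => dist (y i) (y j) ≤ δ) 1 m with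
      h | ⟨U, hU, h⟩
    · exact absurd h (by simpa using hmatch 0 hK)
    · refine ⟨U, hU, fun i hi j hij hd => ?_⟩
      rcases h i (fun _ => j) hi (fun _ => hd) (hinj2 i j hij) with h | ⟨_, h⟩
      exacts [Or.inl h, Or.inr h]
  obtain ⟨U₂, hU₂card, hU₂⟩ : ∃ U : Finset (Fin n), U.card ≤ 3 * m' ∧ (K = 1 ∨
      ∀ i ∈ V, ∀ j k, i ≠ j → i ≠ k → j ≠ k → dist (y i) (y j) ≤ K * δ →
        dist (y i) (y k) ≤ K * δ → i ∈ U ∨ j ∈ U ∨ k ∈ U) := by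
    rcases hcherry with hK1 | hcherry
    · exact ⟨∅, by simp, Or.inl hK1⟩
    rcases exists_starPacking_or_cover (· ∈ V) (fun i j : Fin n => dist (y i) (y j) ≤ K * δ) 2 m'
      with h | ⟨U, hU, h⟩
    · exact absurd h hcherry
    · refine ⟨U, hU, Or.inr fun i hi j k hij hik hjk hj hk => ?_⟩
      have hinj3 : Function.Injective (fun o : Option (Fin 2) => o.elim i ![j, k]) := by
        rintro (_ | a) (_ | b) h
        · rfl
        · fin_cases b
          exacts [absurd h hij, absurd h hik]
        · fin_cases a
          exacts [absurd h.symm hij, absurd h.symm hik]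
        · fin_cases a <;> fin_cases b
          exacts [rfl, absurd h hjk, absurd h.symm hjk, rfl]
      rcases h i ![j, k] hi (fun b => by fin_cases b; exacts [hj, hk]) hinj3 with h | ⟨b, h⟩
      · exact Or.inl h
      · fin_cases b
        exacts [Or.inr (Or.inl h), Or.inr (Or.inr h)]
  set A' := A \ (U₁ ∪ U₂) with hA'
  have hA'mem : ∀ i ∈ A', i ∈ A ∧ i ∉ U₁ ∧ i ∉ U₂ := by
    intro i hi
    simpa [hA'] using hi
  have hsep : ∀ i ∈ A', ∀ j ∈ A', i ≠ j → δ < dist (y i) (y j) := by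
    intro i hi j hj hij
    by_contra hd
    rcases hU₁ i (hAV (hA'mem i hi).1) j hij (not_lt.1 hd) with h | h
    exacts [(hA'mem i hi).2.1 h, (hA'mem j hj).2.1 h]
  have hdeg : ∀ i ∈ A', ∀ j ∈ A', ∀ k ∈ A', i ≠ j → i ≠ k → j ≠ k →
      dist (y i) (y j) ≤ K * δ → ¬ dist (y i) (y k) ≤ K * δ := by
    intro i hi j hj k hk hij hik hjk h1 h2
    -- For `K = 1` the remaining vertices have no near pairs at all, so no bound on cherries is
    -- needed.
    rcases hU₂ with hK1 | hU₂
    · have := hsep i hi j hj hij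
      rw [hK1] at h1
      norm_num at h1
      linarith
    · rcases hU₂ i (hAV (hA'mem i hi).1) j k hij hik hjk h1 h2 with h | h | h
      exacts [(hA'mem i hi).2.2 h, (hA'mem j hj).2.2 h, (hA'mem k hk).2.2 h]
  let F : Finset (Fin n × Fin n) := (A' ×ˢ A').filter fun q => q.1 < q.2
  have hFmem : ∀ q ∈ F, q.1 ∈ A' ∧ q.2 ∈ A' ∧ q.1 < q.2 := by
    intro q hq
    simp only [F, Finset.mem_filter, Finset.mem_product] at hq
    exact ⟨hq.1.1, hq.1.2, hq.2⟩
  have hsum : ∑ q ∈ F, (1 - p) ^ (Δ q.1 q.2).card ≤ m + 1 := by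
    rw [← Finset.sum_filter_add_sum_filter_not F fun q => dist (y q.1) (y q.2) ≤ K * δ]
    refine add_le_add ?_ ?_
    · rw [Finset.filter_filter]
      exact sum_near_pairs_le ((Finset.sdiff_subset).trans hAV) y hδ
        (fun i j => (1 - p) ^ (Δ i j).card) (fun k _ hk => hmatch k hk) hsep hdeg
        (fun i hi j hj => hnear i (hA'mem i hi).1 j (hA'mem j hj).1)
    · have hcardF : (F.card : ℝ) ≤ N ^ 2 := by
        have h1 : A'.card ≤ V.card := Finset.card_le_card (Finset.sdiff_subset.trans hAV)
        have h2 : F.card ≤ A'.card * A'.card :=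
          (Finset.card_filter_le _ _).trans_eq (Finset.card_product _ _)
        have h3 : (A'.card : ℝ) ≤ N := le_trans (by exact_mod_cast h1) hV
        calc (F.card : ℝ) ≤ A'.card * A'.card := by exact_mod_cast h2
          _ ≤ N ^ 2 := by rw [sq]; gcongr
      calc _ ≤ ∑ q ∈ F with ¬ dist (y q.1) (y q.2) ≤ K * δ, 1 / N ^ 2 := by
            refine Finset.sum_le_sum fun q hq => ?_
            obtain ⟨hqF, hqd⟩ := Finset.mem_filter.1 hq
            obtain ⟨h1, h2, h3⟩ := hFmem q hqF
            exact hfar _ (hA'mem _ h1).1 _ (hA'mem _ h2).1 h3.ne (not_le.1 hqd)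
        _ ≤ N ^ 2 * (1 / N ^ 2) := by
            rw [Finset.sum_const, nsmul_eq_mul]
            gcongr
            exact le_trans (by exact_mod_cast Finset.card_filter_le _ _) hcardF
        _ = 1 := by field_simp
  obtain ⟨W₀, hW₀V, hW₀⟩ := exists_subset_card_add_card_unhit_le V F (fun q => Δ q.1 q.2)
    (fun q hq => hΔ _ (hA'mem _ (hFmem q hq).1).1 _ (hA'mem _ (hFmem q hq).2.1).1) hp0 hp1
  set B := F.filter fun q => Disjoint (Δ q.1 q.2) W₀ with hB
  -- The sensors are the random set, one endpoint of each missed pair, and both covers. Only centres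
  -- are known to lie in `V`, so the covers are cut down to `V`; this loses nothing for vertices of
  -- `A`. The count is `(p N + m + 1) + 2 m + 3 m'`.
  refine ⟨W₀ ∪ B.image Prod.fst ∪ (U₁ ∩ V) ∪ (U₂ ∩ V), ?_, ?_, ?_⟩
  · refine Finset.union_subset (Finset.union_subset (Finset.union_subset hW₀V ?_)
      Finset.inter_subset_right) Finset.inter_subset_right
    intro i hi
    obtain ⟨q, hq, rfl⟩ := Finset.mem_image.1 hi
    exact hAV (hA'mem _ (hFmem q (Finset.mem_filter.1 hq).1).1).1
  · have h1 : (W₀ ∪ B.image Prod.fst ∪ (U₁ ∩ V) ∪ (U₂ ∩ V)).card ≤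
        W₀.card + B.card + 2 * m + 3 * m' := by
      refine (Finset.card_union_le _ _).trans (add_le_add ((Finset.card_union_le _ _).trans
        (add_le_add ((Finset.card_union_le _ _).trans
          (add_le_add le_rfl Finset.card_image_le)) ?_)) ?_)
      · exact (Finset.card_le_card Finset.inter_subset_left).trans hU₁card
      · exact (Finset.card_le_card Finset.inter_subset_left).trans hU₂card
    have h2 : ((W₀ ∪ B.image Prod.fst ∪ (U₁ ∩ V) ∪ (U₂ ∩ V)).card : ℝ) ≤
        W₀.card + B.card + 2 * m + 3 * m' := by exact_mod_cast h1
    have h3 : p * V.card ≤ p * N := by gcongr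
    linarith
  · intro i hi j hj hij
    simp only [Finset.mem_union, Finset.mem_inter, Finset.mem_image]
    by_cases hiA : i ∈ A'
    · by_cases hjA : j ∈ A'
      · have hqF : (i, j) ∈ F := by
          simp only [F, Finset.mem_filter, Finset.mem_product]
          exact ⟨⟨hiA, hjA⟩, hij⟩
        by_cases hd : Disjoint (Δ i j) W₀
        · exact Or.inl (Or.inl (Or.inl (Or.inr ⟨(i, j), Finset.mem_filter.2 ⟨hqF, hd⟩, rfl⟩)))
        · refine Or.inr (Or.inr fun h => hd (h.mono_right ?_))
          exact Finset.subset_union_left.trans (Finset.subset_union_left.trans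
            Finset.subset_union_left)
      · have h1 : j ∈ U₁ ∨ j ∈ U₂ := by
          by_contra h
          exact hjA (by simp only [hA', Finset.mem_sdiff, Finset.mem_union]; exact ⟨hj, h⟩)
        rcases h1 with h | h
        exacts [Or.inr (Or.inl (Or.inl (Or.inr ⟨h, hAV hj⟩))), Or.inr (Or.inl (Or.inr ⟨h, hAV hj⟩))]
    · have h1 : i ∈ U₁ ∨ i ∈ U₂ := by
        by_contra h
        exact hiA (by simp only [hA', Finset.mem_sdiff, Finset.mem_union]; exact ⟨hi, h⟩)
      rcases h1 with h | h
      exacts [Or.inl (Or.inl (Or.inr ⟨h, hAV hi⟩)), Or.inl (Or.inr ⟨h, hAV hi⟩)]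

end Resolving

/-! ### From hits to signatures -/

section Graph

variable {n : ℕ}

theorem adj_iff_sqDist_le {x : Fin n → ℝ × ℝ} {r : ℝ} (hr : 0 ≤ r) {i j : Fin n} :
    (torusGraph r x).Adj i j ↔
      i ≠ j ∧ sqDist (toSupTorus n (x i)) (toSupTorus n (x j)) ≤ r ^ 2 := by
  rw [← torusDist_le_iff hr]
  rfl

/-- A sensor is at distance `0` from itself only, and a hit is at distance `1` from exactly one of
the two vertices. -/
theorem distinguishes_of_resolving {x : Fin n → ℝ × ℝ} {r : ℝ} (hr : 0 ≤ r)
    {W A : Finset (Fin n)}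
    (h : ∀ i ∈ A, ∀ j ∈ A, i < j → i ∈ W ∨ j ∈ W ∨ ¬ Disjoint
      (pairHits (discSymmDiff √(n : ℝ) r) (fun i => toSupTorus n (x i)) i j) W) :
    Distinguishes (torusGraph r x) W A := by
  have hlt : ∀ i ∈ A, ∀ j ∈ A, i < j →
      signature (torusGraph r x) W i ≠ signature (torusGraph r x) W j := by
    intro i hi j hj hij heq
    have heq' : ∀ k ∈ W, (torusGraph r x).edist k i = (torusGraph r x).edist k j :=
      fun k hk => congrFun heq ⟨k, hk⟩
    rcases h i hi j hj hij with hW | hW | hW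
    · have h1 := heq' i hW
      rw [SimpleGraph.edist_self, eq_comm, SimpleGraph.edist_eq_zero_iff] at h1
      exact hij.ne h1
    · have h1 := heq' j hW
      rw [SimpleGraph.edist_self, SimpleGraph.edist_eq_zero_iff] at h1
      exact hij.ne' h1
    · obtain ⟨k, hk, hkW⟩ := Finset.not_disjoint_iff.1 hW
      simp only [pairHits, Finset.mem_filter, Finset.mem_univ, true_and] at hk
      obtain ⟨hki, hkj, hk⟩ := hk
      have h1 := heq' k hkW
      have h2 : (torusGraph r x).Adj k i ↔ (torusGraph r x).Adj k j := by
        rw [← SimpleGraph.edist_eq_one_iff_adj, ← SimpleGraph.edist_eq_one_iff_adj, h1]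
      rw [adj_iff_sqDist_le hr, adj_iff_sqDist_le hr, sqDist_comm, sqDist_comm (toSupTorus n (x k))]
        at h2
      rcases hk with hk | hk
      · exact hk.2 (h2.1 ⟨hki, hk.1⟩).2
      · exact hk.2 (h2.2 ⟨hkj, hk.1⟩).2
  intro i hi j hj heq
  rcases lt_trichotomy i j with hij | hij | hij
  · exact absurd heq (hlt i hi j hj hij)
  · exact hij
  · exact absurd heq.symm (hlt j hj i hi hij)

/-- A hit is within `r` of `i` or `j`; this is what the margin of the internal square is for. -/
theorem pairHits_subset_of_closedBall [Fact (0 < √(n : ℝ))] {y : Fin n → SupTorus √(n : ℝ)}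
    {c : SupTorus √(n : ℝ)} {r ρ : ℝ} (hr : 0 ≤ r) {i j k : Fin n}
    (hi : y i ∈ Metric.closedBall c (ρ - r)) (hj : y j ∈ Metric.closedBall c (ρ - r))
    (hk : k ∈ pairHits (discSymmDiff √(n : ℝ) r) y i j) : y k ∈ Metric.closedBall c ρ := by
  simp only [pairHits, Finset.mem_filter, Finset.mem_univ, true_and] at hk
  rw [Metric.mem_closedBall] at hi hj ⊢
  rcases hk.2.2 with h | h
  · have h1 := dist_le_of_sqDist_le hr h.1
    simp only at h1
    linarith [dist_triangle_left (y k) c (y i)]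
  · have h1 := dist_le_of_sqDist_le hr h.1
    simp only at h1
    linarith [dist_triangle_left (y k) c (y j)]

end Graph

/-! ### Reduction to a single square -/

section Reduction

variable {n : ℕ} [hL : Fact (0 < √(n : ℝ))]

/-- Reduction to events that concern a single ball of the torus. -/
theorem one_sub_le_pointsLaw {r w b b₀ : ℝ} (hr : 1 ≤ r) (hb : 0 ≤ b) (hb₀ : 0 ≤ b₀)
    {bad : SupTorus √(n : ℝ) → Set (Fin n → SupTorus √(n : ℝ))}
    {bad₀ : Set (Fin n → SupTorus √(n : ℝ))}
    (hbad : ∀ c, (Measure.pi fun _ => torusLaw n) (bad c) ≤ ENNReal.ofReal b)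
    (hbad₀ : (Measure.pi fun _ => torusLaw n) bad₀ ≤ ENNReal.ofReal b₀)
    (hdet : ∀ (x : Fin n → ℝ × ℝ) (c : SupTorus √(n : ℝ)),
      (fun i => toSupTorus n (x i)) ∉ bad c → (fun i => toSupTorus n (x i)) ∉ bad₀ →
      ∃ W : Finset (Fin n),
        (∀ i ∈ W, toSupTorus n (x i) ∈ Metric.closedBall c (5 * 10 ^ 4 * r)) ∧ (W.card : ℝ) ≤ w ∧
        Distinguishes (torusGraph r x) W
          {i | toSupTorus n (x i) ∈ Metric.closedBall c (5 * 10 ^ 4 * r - r)}) :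
    1 - ENNReal.ofReal (n ^ 2 * b + b₀) ≤ pointsLaw n
      {x | ∀ S ∈ squareFamily n r, ∃ W : Finset (Fin n), (W : Set (Fin n)) ⊆ verticesIn x S ∧
        (W.card : ℝ) ≤ w ∧ Distinguishes (torusGraph r x) W (verticesIn x (S.internal r))} := by
  set G := {x : Fin n → ℝ × ℝ | ∀ S ∈ squareFamily n r, ∃ W : Finset (Fin n),
    (W : Set (Fin n)) ⊆ verticesIn x S ∧ (W.card : ℝ) ≤ w ∧
    Distinguishes (torusGraph r x) W (verticesIn x (S.internal r))} with hG
  have hn0 : (0 : ℝ) < n := Real.sqrt_pos.1 hL.out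
  let ctr : ℕ → ℕ → SupTorus √(n : ℝ) := fun i j =>
    toSupTorus n (10 ^ 4 * r * i + 10 ^ 5 * r / 2, 10 ^ 4 * r * j + 10 ^ 5 * r / 2)
  let U : Set (Fin n → SupTorus √(n : ℝ)) :=
    (⋃ i ∈ Finset.range n, ⋃ j ∈ Finset.range n, bad (ctr i j)) ∪ bad₀
  have hU : (Measure.pi fun _ => torusLaw n) U ≤ ENNReal.ofReal (n ^ 2 * b + b₀) := by
    rw [ENNReal.ofReal_add (by positivity) hb₀]
    refine (measure_union_le _ _).trans (add_le_add ?_ hbad₀)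
    calc _ ≤ ∑ i ∈ Finset.range n, ∑ j ∈ Finset.range n, ENNReal.ofReal b := by
          refine (measure_biUnion_finset_le _ _).trans ?_
          refine Finset.sum_le_sum fun i _ => (measure_biUnion_finset_le _ _).trans ?_
          exact Finset.sum_le_sum fun j _ => hbad _
      _ = _ := by
          rw [ENNReal.ofReal_mul (by positivity), ENNReal.ofReal_pow (by positivity)]
          simp [sq, mul_assoc]
  have hidx : ∀ i : ℕ, 10 ^ 4 * r * i < √(n : ℝ) → i ∈ Finset.range n := by
    intro i hi
    rw [Finset.mem_range]
    have h1 : (1 : ℝ) ≤ n := by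
      have : 0 < n := by exact_mod_cast hn0
      exact_mod_cast this
    have h2 : √(n : ℝ) ≤ n := Real.sqrt_le_left (by positivity) |>.2 (by nlinarith)
    have h3 : (i : ℝ) ≤ 10 ^ 4 * r * i := by
      have : (0 : ℝ) ≤ i := Nat.cast_nonneg i
      nlinarith
    exact_mod_cast (h3.trans_lt hi).trans_le h2
  have hsub : ∀ x, (fun i => toSupTorus n (x i)) ∉ U → x ∈ G := by
    rintro x hx S ⟨i, j, hi, hj, rfl⟩
    have h1 : (fun k => toSupTorus n (x k)) ∉ bad (ctr i j) := fun h =>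
      hx (Or.inl (Set.mem_biUnion (hidx i hi) (Set.mem_biUnion (hidx j hj) h)))
    obtain ⟨W, hWS, hWw, hW⟩ := hdet x (ctr i j) h1 fun h => hx (Or.inr h)
    refine ⟨W, ?_, hWw, ?_⟩
    · intro k hk
      rw [mem_verticesIn_iff]
      convert hWS k hk using 2
      simp only
      ring
    · convert hW using 1
      ext k
      rw [mem_verticesIn_iff]
      simp only [Square.internal, ctr, Set.mem_ofPred_eq]
      rw [show 10 ^ 4 * r * i + r + (10 ^ 5 * r - 2 * r) / 2 = 10 ^ 4 * r * i + 10 ^ 5 * r / 2 by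
        ring, show 10 ^ 4 * r * j + r + (10 ^ 5 * r - 2 * r) / 2 = 10 ^ 4 * r * j + 10 ^ 5 * r / 2 by
        ring, show (10 ^ 5 * r - 2 * r) / 2 = 5 * 10 ^ 4 * r - r by ring]
  have hmp := measurePreserving_toSupTorus_pi (n := n)
  have hpre : pointsLaw n ((fun (x : Fin n → ℝ × ℝ) i => toSupTorus n (x i)) ⁻¹' U) ≤
      ENNReal.ofReal (n ^ 2 * b + b₀) := by
    -- An inequality suffices here, so the bad events need not be measurable.
    refine (Measure.le_map_apply hmp.measurable.aemeasurable U).trans ?_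
    rw [hmp.map_eq]
    exact hU
  have : IsProbabilityMeasure (pointsLaw n) := by
    unfold pointsLaw
    infer_instance
  rw [tsub_le_iff_right]
  calc (1 : ENNReal) = pointsLaw n Set.univ := measure_univ.symm
    _ ≤ pointsLaw n (G ∪ (fun (x : Fin n → ℝ × ℝ) i => toSupTorus n (x i)) ⁻¹' U) := by
        refine measure_mono fun x _ => ?_
        by_cases hx : (fun i => toSupTorus n (x i)) ∈ U
        exacts [Or.inr hx, Or.inl (hsub x hx)]
    _ ≤ pointsLaw n G + ENNReal.ofReal (n ^ 2 * b + b₀) :=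
        (measure_union_le _ _).trans (by gcongr)

theorem measure_crowded_le (c : SupTorus √(n : ℝ)) {r : ℝ} (hr : 0 ≤ r) :
    (Measure.pi fun _ : Fin n => torusLaw n)
      {y | 2 * (10 ^ 10 * r ^ 2) ≤ hitCount (Metric.closedBall c (5 * 10 ^ 4 * r)) y} ≤
      ENNReal.ofReal (Real.exp (-(10 ^ 10 * r ^ 2 / 4))) := by
  have hn0 : (0 : ℝ) < n := Real.sqrt_pos.1 hL.out
  rw [← ofReal_measureReal]
  refine ENNReal.ofReal_le_ofReal (measureReal_two_mul_le_hitCount_le _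
    Metric.isClosed_closedBall.measurableSet ?_)
  have h1 : (torusLaw n).real (Metric.closedBall c (5 * 10 ^ 4 * r)) ≤
      4 * (5 * 10 ^ 4 * r) ^ 2 / n :=
    ENNReal.toReal_le_of_le_ofReal (by positivity) (torusLaw_closedBall_le c (by positivity))
  rw [Fintype.card_fin]
  calc (n : ℝ) * (torusLaw n).real (Metric.closedBall c (5 * 10 ^ 4 * r))
      ≤ n * (4 * (5 * 10 ^ 4 * r) ^ 2 / n) := by gcongr
    _ = 10 ^ 10 * r ^ 2 := by field_simp; ring

/-- The bound for small radii: all vertices of the square serve as sensors. -/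
theorem one_sub_le_pointsLaw_of_all {r : ℝ} (hr : 1 ≤ r) :
    1 - ENNReal.ofReal (n ^ 2 * Real.exp (-(10 ^ 10 * r ^ 2 / 4)) + 0) ≤ pointsLaw n
      {x | ∀ S ∈ squareFamily n r, ∃ W : Finset (Fin n), (W : Set (Fin n)) ⊆ verticesIn x S ∧
        (W.card : ℝ) ≤ 2 * 10 ^ 10 * r ^ 2 ∧
        Distinguishes (torusGraph r x) W (verticesIn x (S.internal r))} := by
  classical
  refine one_sub_le_pointsLaw (bad₀ := ∅) hr (Real.exp_nonneg _) le_rfl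
    (fun c => measure_crowded_le c (by linarith)) (by simp) fun x c hx _ => ?_
  refine ⟨Finset.univ.filter fun i => toSupTorus n (x i) ∈ Metric.closedBall c (5 * 10 ^ 4 * r),
    fun i hi => (Finset.mem_filter.1 hi).2, ?_, ?_⟩
  · rw [Set.mem_ofPred_eq, not_le] at hx
    have h1 := hx.le
    rw [hitCount] at h1
    refine le_trans (le_of_eq ?_) (h1.trans_eq (by ring))
    congr
  · have h2 : {i | toSupTorus n (x i) ∈ Metric.closedBall c (5 * 10 ^ 4 * r - r)} =
        ((Finset.univ.filter fun i =>
          toSupTorus n (x i) ∈ Metric.closedBall c (5 * 10 ^ 4 * r - r) : Finset (Fin n)) :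
            Set (Fin n)) := by
      ext i
      simp
    rw [h2]
    refine distinguishes_of_resolving (by linarith) fun i hi j _ _ => Or.inl ?_
    refine Finset.mem_filter.2 ⟨Finset.mem_univ _, ?_⟩
    exact Metric.closedBall_subset_closedBall (by linarith) (Finset.mem_filter.1 hi).2

end Reduction

/-! ### Scales, bad events and the sparse construction -/

section SparseSensors

/-- The number of distance scales that are treated separately. -/
theorem exists_scales {r l : ℝ} (hl : 1 ≤ l) (hrl : 100 * l ≤ r) (hr3 : r ^ 2 ≤ l ^ 3)
    (hbig : 10 ^ 32 * (3 / 2 * Real.log l + 1) ^ 8 ≤ l) :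
    ∃ K : ℕ, 1 ≤ K ∧ (K : ℝ) ≤ r ∧ K * (10 * l / r) ≤ r ∧
      (K = 1 ∨ 10 ^ 16 * (K : ℝ) ^ 4 * l ^ 2 ≤ r ^ 2) ∧
      (2 * (10 ^ 10 * r ^ 2)) ^ 2 ≤ Real.exp (5000 * K * l ^ 3 / r ^ 2) := by
  have hr100 : 100 ≤ r := by linarith
  have hr0 : 0 < r := by linarith
  have hlr : 10 * l / r ≤ 1 := by
    rw [div_le_one hr0]
    linarith
  -- For `r^4 < l^5` the decay at scale `1` already beats the number of pairs. Otherwise cherries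
  -- are rare enough to allow about `log r` scales.
  rcases lt_or_ge (r ^ 4) (l ^ 5) with h | h
  · refine ⟨1, le_rfl, by norm_num; linarith, by norm_num; linarith, Or.inl rfl, ?_⟩
    set t := l ^ 3 / r ^ 2 with ht
    have ht0 : 0 < t := by positivity
    have ht2 : l ≤ t ^ 2 := by
      rw [ht, div_pow, le_div_iff₀ (by positivity)]
      nlinarith [pow_pos hr0 4]
    -- The tenth Taylor term is enough, since `t^10 ≥ l^5 > r^4`.
    have h1 := Real.pow_div_factorial_le_exp (5000 * t) (by positivity) 10
    have h2 : l ^ 5 ≤ t ^ 10 := by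
      calc l ^ 5 ≤ (t ^ 2) ^ 5 := by gcongr
        _ = t ^ 10 := by ring
    have h3 : (5000 * ((1 : ℕ) : ℝ) * l ^ 3 / r ^ 2) = 5000 * t := by
      rw [ht]
      push_cast
      ring
    rw [h3]
    refine le_trans ?_ h1
    rw [mul_pow 5000 t, show ((Nat.factorial 10 : ℕ) : ℝ) = 3628800 by norm_num [Nat.factorial]]
    have h4 : (0 : ℝ) ≤ t ^ 10 := by positivity
    calc (2 * (10 ^ 10 * r ^ 2)) ^ 2 = 4 * 10 ^ 20 * r ^ 4 := by ring
      _ ≤ 4 * 10 ^ 20 * t ^ 10 := by gcongr; linarith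
      _ ≤ 5000 ^ 10 / 3628800 * t ^ 10 := by gcongr; norm_num
      _ = _ := by ring
  -- With `K = ⌈log r⌉` the exponential is at least `r^15`, while `K^8` is negligible against `l`
  -- because `log r ≤ (3/2) log l`.
  · have hlog1 : 1 ≤ Real.log r := by
      rw [Real.le_log_iff_exp_le hr0]
      linarith [Real.exp_one_lt_d9]
    have hK1 : Real.log r ≤ ⌈Real.log r⌉₊ := Nat.le_ceil _
    have hK2 : (⌈Real.log r⌉₊ : ℝ) < Real.log r + 1 := Nat.ceil_lt_add_one (by linarith)
    have hlogr : Real.log r ≤ 3 / 2 * Real.log l := by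
      have h1 := Real.log_le_log (by positivity) hr3
      rw [Real.log_pow, Real.log_pow] at h1
      push_cast at h1
      linarith
    set K := ⌈Real.log r⌉₊ with hK
    have hKr : (K : ℝ) ≤ r := by linarith [Real.log_le_sub_one_of_pos hr0]
    refine ⟨K, ?_, hKr, ?_, Or.inr ?_, ?_⟩
    · have : (1 : ℝ) ≤ K := hlog1.trans hK1
      exact_mod_cast this
    · exact (mul_le_of_le_one_right (by positivity) hlr).trans hKr
    · have h8 : (K : ℝ) ^ 8 ≤ (3 / 2 * Real.log l + 1) ^ 8 := by
        gcongr
        linarith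
      have h9 : 10 ^ 32 * (K : ℝ) ^ 8 ≤ l := le_trans (by gcongr) hbig
      refine le_of_sq_le_sq ?_ (by positivity)
      calc (10 ^ 16 * (K : ℝ) ^ 4 * l ^ 2) ^ 2 = 10 ^ 32 * (K : ℝ) ^ 8 * l ^ 4 := by ring
        _ ≤ l * l ^ 4 := by gcongr
        _ ≤ (r ^ 2) ^ 2 := by linarith
    · have h1 : (15 : ℝ) * Real.log r ≤ 5000 * K * l ^ 3 / r ^ 2 := by
        have h2 : 1 ≤ l ^ 3 / r ^ 2 := by
          rw [one_le_div (by positivity)]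
          exact hr3
        rw [mul_div_assoc]
        nlinarith
      refine le_trans ?_ (Real.exp_le_exp.2 h1)
      rw [show (15 : ℝ) * Real.log r = ((15 : ℕ) : ℝ) * Real.log r by norm_num,
        ← Real.log_pow, Real.exp_log (by positivity)]
      calc (2 * (10 ^ 10 * r ^ 2)) ^ 2 = 4 * 10 ^ 20 * r ^ 4 := by ring
        _ ≤ 100 ^ 11 * r ^ 4 := by gcongr; norm_num
        _ ≤ r ^ 11 * r ^ 4 := by gcongr
        _ = r ^ 15 := by ring

theorem measurableSet_dist_le {L : ℝ} (d : ℝ) :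
    MeasurableSet {q : SupTorus L × SupTorus L | dist q.1 q.2 ≤ d} :=
  (isClosed_le continuous_dist continuous_const).measurableSet

variable {n : ℕ} [hL : Fact (0 < √(n : ℝ))]

/-- The configurations for which some ball contains too many vertices, too many disjoint close
pairs, or too many disjoint cherries. -/
def badBall (r l : ℝ) (K m m' : ℕ) (c : SupTorus √(n : ℝ)) : Set (Fin n → SupTorus √(n : ℝ)) :=
  {y | 2 * (10 ^ 10 * r ^ 2) ≤ hitCount (Metric.closedBall c (5 * 10 ^ 4 * r)) y} ∪
  ((⋃ k ∈ Finset.range K, {y | ∃ (C : Finset (Fin n)) (g : Fin n → Fin 1 → Fin n),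
    C.card = 4 ^ k * m ∧
      IsStarPacking (fun i => y i ∈ Metric.closedBall c (5 * 10 ^ 4 * r))
        (fun i j => (y i, y j) ∈ {q : SupTorus √(n : ℝ) × SupTorus √(n : ℝ) |
          dist q.1 q.2 ≤ (k + 1) * (10 * l / r)}) C g}) ∪
  {y | K ≠ 1 ∧ ∃ (C : Finset (Fin n)) (g : Fin n → Fin 2 → Fin n), C.card = m' ∧
      IsStarPacking (fun i => y i ∈ Metric.closedBall c (5 * 10 ^ 4 * r))
        (fun i j => (y i, y j) ∈ {q : SupTorus √(n : ℝ) × SupTorus √(n : ℝ) |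
          dist q.1 q.2 ≤ K * (10 * l / r)}) C g})

theorem torusLaw_section_dist_le (u : SupTorus √(n : ℝ)) {d : ℝ} (hd : 0 ≤ d) :
    torusLaw n (Prod.mk u ⁻¹' {q : SupTorus √(n : ℝ) × SupTorus √(n : ℝ) | dist q.1 q.2 ≤ d}) ≤
      ENNReal.ofReal (4 * d ^ 2 / n) := by
  refine le_trans (measure_mono ?_) (torusLaw_closedBall_le u hd)
  intro v hv
  rw [Metric.mem_closedBall, dist_comm]
  exact hv

theorem half_pow_le_exp {l : ℝ} (hl : 10 ≤ l) {m : ℕ} (hm : l ^ 2 ≤ m) :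
    (1 / 2 : ℝ) ^ m ≤ Real.exp (-(5 * l)) := by
  have h1 : (1 / 2 : ℝ) ≤ Real.exp (-(1 / 2)) := by
    linarith [Real.add_one_le_exp (-(1 / 2) : ℝ)]
  calc (1 / 2 : ℝ) ^ m ≤ Real.exp (-(1 / 2)) ^ m := by gcongr
    _ = Real.exp (m * -(1 / 2)) := by rw [Real.exp_nat_mul]
    _ ≤ _ := by
        rw [Real.exp_le_exp]
        nlinarith

theorem sq_succ_le_four_pow (k : ℕ) : (k + 1) ^ 2 ≤ 4 ^ k := by
  induction k with
  | zero => norm_num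
  | succ k ih =>
    have : (k + 1 + 1) ^ 2 ≤ 4 * (k + 1) ^ 2 := by ring_nf; nlinarith [sq_nonneg k]
    rw [pow_succ 4]
    omega

/-- With `β = 10^10 r^2` and `γ = 4 (k + 1)^2 δ^2`, the product `6 β γ` equals `24 · 10^12 l^2 (k +
1)^2`, and `(k + 1)^2 ≤ 4^k`. For cherries `6 β γ^2` is at most `l^2` by the choice of `K`. -/
theorem measure_badBall_le {r l : ℝ} (hl : 10 ≤ l) (hrl : 100 * l ≤ r) {K m m' : ℕ}
    (hm : 24 * 10 ^ 12 * l ^ 2 ≤ m) (hm' : l ^ 2 ≤ m')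
    (hK : K = 1 ∨ 10 ^ 16 * (K : ℝ) ^ 4 * l ^ 2 ≤ r ^ 2) (c : SupTorus √(n : ℝ)) :
    (Measure.pi fun _ => torusLaw n) (badBall r l K m m' c) ≤
      ENNReal.ofReal ((K + 2) * Real.exp (-(5 * l))) := by
  have hr0 : 0 < r := by linarith
  have hB : torusLaw n (Metric.closedBall c (5 * 10 ^ 4 * r)) ≤
      ENNReal.ofReal (10 ^ 10 * r ^ 2 / n) := by
    refine (torusLaw_closedBall_le c (by positivity)).trans_eq ?_
    congr 2
    ring
  have h1 : (Measure.pi fun _ : Fin n => torusLaw n)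
      {y | 2 * (10 ^ 10 * r ^ 2) ≤ hitCount (Metric.closedBall c (5 * 10 ^ 4 * r)) y} ≤
      ENNReal.ofReal (Real.exp (-(5 * l))) := by
    refine (measure_crowded_le c hr0.le).trans (ENNReal.ofReal_le_ofReal ?_)
    rw [Real.exp_le_exp]
    nlinarith
  have h2 : ∀ k : ℕ, (Measure.pi fun _ => torusLaw n)
      {y | ∃ (C : Finset (Fin n)) (g : Fin n → Fin 1 → Fin n), C.card = 4 ^ k * m ∧
        IsStarPacking (fun i => y i ∈ Metric.closedBall c (5 * 10 ^ 4 * r))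
          (fun i j => (y i, y j) ∈ {q : SupTorus √(n : ℝ) × SupTorus √(n : ℝ) |
            dist q.1 q.2 ≤ (k + 1) * (10 * l / r)}) C g} ≤
      ENNReal.ofReal (Real.exp (-(5 * l))) := by
    intro k
    have hk : ((k : ℝ) + 1) ^ 2 ≤ 4 ^ k := by exact_mod_cast sq_succ_le_four_pow k
    have h4 : (1 : ℝ) ≤ 4 ^ k := one_le_pow₀ (by norm_num)
    refine (measure_exists_starPacking_le (torusLaw n) Metric.isClosed_closedBall.measurableSet
      (measurableSet_dist_le _) 1 (4 ^ k * m) (by positivity)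
      (γ := 4 * (((k : ℝ) + 1) * (10 * l / r)) ^ 2) (by positivity) hB
      (fun u => torusLaw_section_dist_le u (by positivity)) ?_).trans
      (ENNReal.ofReal_le_ofReal (half_pow_le_exp hl ?_))
    · calc (6 * (10 ^ 10 * r ^ 2 * (4 * (((k : ℝ) + 1) * (10 * l / r)) ^ 2) ^ 1) : ℝ)
          = ((k : ℝ) + 1) ^ 2 * (24 * 10 ^ 12 * l ^ 2) := by
            field_simp
            ring
        _ ≤ 4 ^ k * (m : ℝ) := by gcongr
        _ = ((4 ^ k * m : ℕ) : ℝ) := by push_cast; ring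
    · push_cast
      nlinarith [sq_nonneg l]
  have h3 : (Measure.pi fun _ => torusLaw n)
      {y | K ≠ 1 ∧ ∃ (C : Finset (Fin n)) (g : Fin n → Fin 2 → Fin n), C.card = m' ∧
        IsStarPacking (fun i => y i ∈ Metric.closedBall c (5 * 10 ^ 4 * r))
          (fun i j => (y i, y j) ∈ {q : SupTorus √(n : ℝ) × SupTorus √(n : ℝ) |
            dist q.1 q.2 ≤ K * (10 * l / r)}) C g} ≤
      ENNReal.ofReal (Real.exp (-(5 * l))) := by
    rcases hK with hK | hK
    · simp [hK]
    refine (measure_mono fun y hy => hy.2).trans ((measure_exists_starPacking_le (torusLaw n)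
      Metric.isClosed_closedBall.measurableSet (measurableSet_dist_le _) 2 m' (by positivity)
      (γ := 4 * ((K : ℝ) * (10 * l / r)) ^ 2) (by positivity) hB
      (fun u => torusLaw_section_dist_le u (by positivity)) ?_).trans
      (ENNReal.ofReal_le_ofReal (half_pow_le_exp hl hm')))
    refine le_trans ?_ hm'
    calc 6 * (10 ^ 10 * r ^ 2 * (4 * ((K : ℝ) * (10 * l / r)) ^ 2) ^ 2)
        = 96 / 100 * (10 ^ 16 * (K : ℝ) ^ 4 * l ^ 2) * l ^ 2 / r ^ 2 := by field_simp; ring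
      _ ≤ 1 * r ^ 2 * l ^ 2 / r ^ 2 := by gcongr; norm_num
      _ = l ^ 2 := by field_simp
  have hsum : ENNReal.ofReal ((K + 2) * Real.exp (-(5 * l))) =
      ENNReal.ofReal (Real.exp (-(5 * l))) + (K * ENNReal.ofReal (Real.exp (-(5 * l))) +
        ENNReal.ofReal (Real.exp (-(5 * l)))) := by
    have he := Real.exp_nonneg (-(5 * l))
    rw [← ENNReal.ofReal_natCast K, ← ENNReal.ofReal_mul (by positivity),
      ← ENNReal.ofReal_add (by positivity) he, ← ENNReal.ofReal_add he (by positivity)]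
    congr 1
    ring
  rw [hsum]
  refine (measure_union_le _ _).trans (add_le_add h1 ((measure_union_le _ _).trans
    (add_le_add ?_ h3)))
  refine (measure_biUnion_finset_le _ _).trans ((Finset.sum_le_sum fun k _ => h2 k).trans_eq ?_)
  simp

theorem one_sub_pow_le_exp {p t : ℝ} (hp0 : 0 ≤ p) (hp1 : p ≤ 1) {N : ℕ} (ht : t ≤ N) :
    (1 - p) ^ N ≤ Real.exp (-(p * t)) := by
  calc (1 - p) ^ N ≤ Real.exp (-p) ^ N := by
        exact pow_le_pow_left₀ (by linarith) (Real.one_sub_le_exp_neg p) N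
    _ = Real.exp (N * -p) := by rw [Real.exp_nat_mul]
    _ ≤ _ := by
        rw [Real.exp_le_exp]
        nlinarith

theorem one_sub_le_pointsLaw_of_sparse {r l : ℝ} (hn : 100 ≤ n) (hl : 10 ≤ l)
    (hrl : 100 * l ≤ r) (hr3 : r ^ 2 ≤ l ^ 3) (hrn : r < √(n : ℝ) / 4)
    (hbig : 10 ^ 32 * (3 / 2 * Real.log l + 1) ^ 8 ≤ l) :
    1 - ENNReal.ofReal (n ^ 2 * ((r + 2) * Real.exp (-(5 * l))) + n ^ 2 * Real.exp (-(5 * l))) ≤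
      pointsLaw n {x | ∀ S ∈ squareFamily n r, ∃ W : Finset (Fin n),
        (W : Set (Fin n)) ⊆ verticesIn x S ∧ (W.card : ℝ) ≤ 10 ^ 15 * l ^ 2 ∧
        Distinguishes (torusGraph r x) W (verticesIn x (S.internal r))} := by
  classical
  have hr0 : 0 < r := by linarith
  have hl0 : 0 < l := by linarith
  obtain ⟨K, hK1, hKr, hKδ, hKc, hKfar⟩ := exists_scales (by linarith) hrl hr3 hbig
  set m := ⌈24 * 10 ^ 12 * l ^ 2⌉₊ with hm
  set m' := ⌈l ^ 2⌉₊ with hm'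
  have hm1 : 24 * 10 ^ 12 * l ^ 2 ≤ (m : ℝ) := Nat.le_ceil _
  have hm2 : (m : ℝ) < 24 * 10 ^ 12 * l ^ 2 + 1 := Nat.ceil_lt_add_one (by positivity)
  have hm'1 : l ^ 2 ≤ (m' : ℝ) := Nat.le_ceil _
  have hm'2 : (m' : ℝ) < l ^ 2 + 1 := Nat.ceil_lt_add_one (by positivity)
  set δ := 10 * l / r with hδ
  have hδ0 : 0 < δ := by positivity
  have hrδ : r * δ = 10 * l := by rw [hδ]; field_simp
  set R := discSymmDiff √(n : ℝ) r with hR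
  let f : SupTorus √(n : ℝ) × SupTorus √(n : ℝ) → ℝ := fun q => r * min (dist q.1 q.2) r
  have hf : Measurable f :=
    (continuous_const.mul (continuous_dist.min continuous_const)).measurable
  refine one_sub_le_pointsLaw (bad := badBall r l K m m')
    (bad₀ := {y | ∃ i j, i ≠ j ∧ 10 * l ≤ f (y i, y j) ∧
      ((pairHits R y i j).card : ℝ) ≤ f (y i, y j) / 20})
    (by linarith) (by positivity) (by positivity) (fun c => ?_) ?_ ?_
  · refine (measure_badBall_le hl hrl hm1 hm'1 hKc c).trans (ENNReal.ofReal_le_ofReal ?_)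
    gcongr
  · refine (measure_exists_pairHits_le (torusLaw n) (measurableSet_discSymmDiff r) hf
      (fun q => le_torusLaw_discSymmDiff q.1 q.2 hr0.le hrn) hn (by positivity)).trans_eq ?_
    congr 4
    ring
  intro x c hx hx₀
  set y : Fin n → SupTorus √(n : ℝ) := fun i => toSupTorus n (x i) with hy
  simp only [badBall, Set.mem_union, not_or, Set.mem_iUnion, not_exists] at hx
  obtain ⟨hcrowd, hmatch, hcherry⟩ := hx
  set V := Finset.univ.filter fun i => y i ∈ Metric.closedBall c (5 * 10 ^ 4 * r) with hV
  set A := Finset.univ.filter fun i => y i ∈ Metric.closedBall c (5 * 10 ^ 4 * r - r) with hA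
  have hAV : A ⊆ V := fun i hi => Finset.mem_filter.2 ⟨Finset.mem_univ _,
    Metric.closedBall_subset_closedBall (by linarith) (Finset.mem_filter.1 hi).2⟩
  have hAset : {i | toSupTorus n (x i) ∈ Metric.closedBall c (5 * 10 ^ 4 * r - r)} =
      (A : Set (Fin n)) := by
    ext i
    simp [hA, hy]
  have hVP : (fun i => y i ∈ Metric.closedBall c (5 * 10 ^ 4 * r)) = (· ∈ V) := by
    ext i
    simp [hV]
  -- The condition `100 l ≤ r` is exactly what makes this density at most `1`.
  set p := 10 ^ 4 * l ^ 2 / r ^ 2 with hp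
  have hp0 : 0 ≤ p := by positivity
  have hp1 : p ≤ 1 := by
    rw [hp, div_le_one (by positivity)]
    nlinarith
  have hdecay : ∀ i j, i ≠ j → ∀ k : ℕ, 1 ≤ k → k ≤ K → k * δ < dist (y i) (y j) →
      (1 - p) ^ (pairHits R y i j).card ≤ Real.exp (-(5000 * k * l ^ 3 / r ^ 2)) := by
    intro i j hij k hk1 hkK hd
    have hk1' : (1 : ℝ) ≤ k := by exact_mod_cast hk1
    -- Up to scale `K` the truncation in `min (dist ..) r` has no effect.
    have hkr : k * δ ≤ r := by
      refine le_trans ?_ hKδ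
      gcongr
    have h1 : 10 * l * k ≤ f (y i, y j) := by
      calc 10 * l * k = r * (k * δ) := by rw [← hrδ]; ring
        _ ≤ _ := mul_le_mul_of_nonneg_left (le_min hd.le hkr) hr0.le
    have h2 : f (y i, y j) / 20 < (pairHits R y i j).card := by
      by_contra h
      refine hx₀ ⟨i, j, hij, ?_, not_lt.1 h⟩
      refine le_trans ?_ h1
      nlinarith
    refine (one_sub_pow_le_exp hp0 hp1 (t := l * k / 2) (by linarith)).trans_eq ?_
    congr 2
    rw [hp]
    field_simp
    ring
  have hres : ∃ W ⊆ V, (W.card : ℝ) ≤ p * (2 * (10 ^ 10 * r ^ 2)) + 3 * m + 3 * m' + 1 ∧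
      ∀ i ∈ A, ∀ j ∈ A, i < j → i ∈ W ∨ j ∈ W ∨ ¬ Disjoint (pairHits R y i j) W := by
    refine exists_resolving_set (K := K) hAV y (pairHits R y) hδ0 hp0 hp1 (by positivity)
      ?_ ?_ hK1 ?_ ?_ ?_ ?_
    · rw [Set.mem_ofPred_eq, not_le, hitCount] at hcrowd
      refine le_trans (le_of_eq ?_) hcrowd.le
      congr
    · intro k hk
      have h1 := hmatch k (Finset.mem_range.2 hk)
      rw [Set.mem_ofPred_eq, hVP] at h1
      exact h1
    · by_cases hK : K = 1
      · exact Or.inl hK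
      · refine Or.inr fun h => hcherry ⟨hK, ?_⟩
        rw [hVP]
        exact h
    · intro i hi j hj k hk
      exact Finset.mem_filter.2 ⟨Finset.mem_univ _, pairHits_subset_of_closedBall hr0.le
        (Finset.mem_filter.1 hi).2 (Finset.mem_filter.1 hj).2 hk⟩
    · intro i _ j _ hij k hk1 hkK hd
      refine (hdecay i j hij k hk1 hkK.le hd).trans ?_
      have h1 : (1 : ℝ) ≤ l ^ 3 / r ^ 2 := by
        rw [one_le_div (by positivity)]
        exact hr3
      have h8 : (Real.exp 7)⁻¹ ≤ 1 / 8 := by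
        rw [one_div]
        gcongr
        linarith [Real.add_one_le_exp (7 : ℝ)]
      calc Real.exp (-(5000 * k * l ^ 3 / r ^ 2)) ≤ Real.exp (k * -7) := by
            rw [Real.exp_le_exp, mul_div_assoc]
            have : (0 : ℝ) ≤ k := Nat.cast_nonneg k
            nlinarith
        _ = ((Real.exp 7)⁻¹) ^ k := by rw [Real.exp_nat_mul, Real.exp_neg]
        _ ≤ (1 / 8) ^ k := by gcongr
    · intro i _ j _ hij hd
      refine (hdecay i j hij K hK1 le_rfl hd).trans ?_
      rw [Real.exp_neg, ← one_div]
      exact one_div_le_one_div_of_le (by positivity) hKfar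
  obtain ⟨W, hWV, hWcard, hW⟩ := hres
  refine ⟨W, fun i hi => (Finset.mem_filter.1 (hWV hi)).2, hWcard.trans ?_, ?_⟩
  -- The random part gives `2 · 10^14 l^2`, and `3 m` and `3 m'` add about `7.5 · 10^13 l^2`, below
  -- `10^15 l^2`.
  · have h1 : p * (2 * (10 ^ 10 * r ^ 2)) = 2 * 10 ^ 14 * l ^ 2 := by
      rw [hp]
      field_simp
    rw [h1]
    nlinarith
  · rw [hAset]
    exact distinguishes_of_resolving hr0.le hW

end SparseSensors

/-! ### Choice of `l` and the limit -/

section Asymptotics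

theorem eventually_log_pow_le :
    ∀ᶠ l : ℝ in atTop, 10 ^ 32 * (3 / 2 * Real.log l + 1) ^ 8 ≤ l := by
  have h1 := (Real.isLittleO_pow_log_id_atTop (n := 8))
    |>.bound (c := 1 / (10 ^ 32 * 3 ^ 8)) (by positivity)
  have h2 := Real.tendsto_log_atTop.eventually_ge_atTop 1
  filter_upwards [h1, h2, eventually_ge_atTop 0] with l h1 h2 h3
  simp only [id, Real.norm_eq_abs, abs_of_nonneg h3] at h1
  rw [abs_of_nonneg (by positivity)] at h1
  calc 10 ^ 32 * (3 / 2 * Real.log l + 1) ^ 8 ≤ 10 ^ 32 * (3 * Real.log l) ^ 8 := by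
        gcongr
        linarith
    _ = 10 ^ 32 * 3 ^ 8 * Real.log l ^ 8 := by ring
    _ ≤ 10 ^ 32 * 3 ^ 8 * (1 / (10 ^ 32 * 3 ^ 8) * l) := by gcongr
    _ = l := by ring

theorem exp_neg_five_mul_le {n : ℕ} (hn : 0 < n) {l : ℝ} (hl : Real.log n ≤ l) :
    Real.exp (-(5 * l)) ≤ 1 / (n : ℝ) ^ 5 := by
  have hn' : (0 : ℝ) < n := by exact_mod_cast hn
  rw [Real.exp_neg, one_div]
  gcongr
  calc (n : ℝ) ^ 5 = Real.exp (Real.log ((n : ℝ) ^ 5)) := (Real.exp_log (by positivity)).symm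
    _ ≤ Real.exp (5 * l) := by
        rw [Real.exp_le_exp, Real.log_pow]
        push_cast
        linarith

theorem failure_bound_le {n : ℕ} (hn : 100 ≤ n) {l r : ℝ} (hl : Real.log n ≤ l)
    (hrn : r < √(n : ℝ) / 4) :
    n ^ 2 * ((r + 2) * Real.exp (-(5 * l))) + n ^ 2 * Real.exp (-(5 * l)) ≤ 4 / (n : ℝ) := by
  have hn' : (100 : ℝ) ≤ n := by exact_mod_cast hn
  have h1 := exp_neg_five_mul_le (by omega) hl
  have h2 : √(n : ℝ) ≤ n := (Real.sqrt_le_left (by positivity)).2 (by nlinarith)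
  have h3 : r + 3 ≤ 4 * n := by linarith
  calc n ^ 2 * ((r + 2) * Real.exp (-(5 * l))) + n ^ 2 * Real.exp (-(5 * l))
      = n ^ 2 * (r + 3) * Real.exp (-(5 * l)) := by ring
    _ ≤ n ^ 2 * (4 * n) * (1 / (n : ℝ) ^ 5) := by gcongr
    _ = 4 / n * (1 / n) := by field_simp
    _ ≤ 4 / n * 1 := by
        gcongr
        rw [div_le_one (by linarith)]
        linarith
    _ = 4 / n := mul_one _

theorem one_sub_le_pointsLaw_sensorBound {n : ℕ} [Fact (0 < √(n : ℝ))] {r : ℝ} (hn : 100 ≤ n)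
    (hlog : 10 ^ 4 ≤ Real.log n)
    (hbig : ∀ l, Real.log n ≤ l → 10 ^ 32 * (3 / 2 * Real.log l + 1) ^ 8 ≤ l)
    (hr6 : 10 ^ 6 ≤ r) (hr : 70 * √(Real.log n) ≤ r) (hrn : r < √(n : ℝ) / 4) :
    1 - ENNReal.ofReal (4 / n) ≤ pointsLaw n
      {x | ∀ S ∈ squareFamily n r, ∃ W : Finset (Fin n), (W : Set (Fin n)) ⊆ verticesIn x S ∧
        (W.card : ℝ) ≤ sensorBound n r ∧
        Distinguishes (torusGraph r x) W (verticesIn x (S.internal r))} := by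
  have hr0 : 0 < r := by linarith
  have hlog0 : 0 ≤ Real.log n := by linarith
  have hsparse : ∀ l, Real.log n ≤ l → 100 * l ≤ r → r ^ 2 ≤ l ^ 3 →
      10 ^ 15 * l ^ 2 ≤ sensorBound n r → 1 - ENNReal.ofReal (4 / n) ≤ pointsLaw n
      {x | ∀ S ∈ squareFamily n r, ∃ W : Finset (Fin n), (W : Set (Fin n)) ⊆ verticesIn x S ∧
        (W.card : ℝ) ≤ sensorBound n r ∧
        Distinguishes (torusGraph r x) W (verticesIn x (S.internal r))} := by
    intro l hl hrl hr3 hw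
    refine (tsub_le_tsub_left (ENNReal.ofReal_le_ofReal (failure_bound_le hn hl hrn)) 1).trans
      ((one_sub_le_pointsLaw_of_sparse hn (by linarith) hrl hr3 hrn (hbig l hl)).trans
        (measure_mono fun x hx S hS => ?_))
    obtain ⟨W, h1, h2, h3⟩ := hx S hS
    exact ⟨W, h1, h2.trans hw, h3⟩
  by_cases h1 : Real.log n ^ (3 / 2 : ℝ) ≤ r
  -- This is the value with `l^3 = r^2`, the least that keeps the decay per scale bounded; `100 l ≤
  -- r` becomes `r ≥ 10^6`.
  · refine hsparse (r ^ (2 / 3 : ℝ)) ?_ ?_ ?_ ?_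
    · calc Real.log n = (Real.log n ^ (3 / 2 : ℝ)) ^ (2 / 3 : ℝ) := by
            rw [← Real.rpow_mul hlog0]
            norm_num
        _ ≤ r ^ (2 / 3 : ℝ) := by gcongr
    · have h2 : (100 : ℝ) ≤ r ^ (1 / 3 : ℝ) := by
        calc (100 : ℝ) = ((10 : ℝ) ^ (6 : ℝ)) ^ (1 / 3 : ℝ) := by
              rw [← Real.rpow_mul (by norm_num)]
              norm_num
          _ ≤ r ^ (1 / 3 : ℝ) := by
              gcongr
              exact_mod_cast hr6
      calc 100 * r ^ (2 / 3 : ℝ) ≤ r ^ (1 / 3 : ℝ) * r ^ (2 / 3 : ℝ) := by gcongr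
        _ = r := by
            rw [← Real.rpow_add hr0]
            norm_num
    · rw [← Real.rpow_natCast (r ^ (2 / 3 : ℝ)) 3, ← Real.rpow_mul hr0.le]
      norm_num
    · rw [sensorBound, if_pos h1, ← Real.rpow_natCast (r ^ (2 / 3 : ℝ)) 2, ← Real.rpow_mul hr0.le]
      norm_num
  by_cases h2 : 100 * Real.log n ≤ r
  · refine hsparse (Real.log n) le_rfl h2 ?_ ?_
    · calc r ^ 2 ≤ (Real.log n ^ (3 / 2 : ℝ)) ^ 2 := by
            gcongr
            exact (not_le.1 h1).le
        _ = Real.log n ^ 3 := by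
            rw [← Real.rpow_natCast (Real.log n ^ (3 / 2 : ℝ)) 2, ← Real.rpow_mul hlog0,
              ← Real.rpow_natCast (Real.log n) 3]
            norm_num
    · rw [sensorBound, if_neg h1, if_pos h2]
      nlinarith [sq_nonneg (Real.log n)]
  -- Here every vertex of the square is a sensor; `r^2 ≥ log n` makes the crowding probability at
  -- most `exp (-5 log n)`.
  · have h3 : Real.log n ≤ r ^ 2 := by
      have h4 : (√(Real.log n)) ^ 2 = Real.log n := Real.sq_sqrt hlog0
      nlinarith [Real.sqrt_nonneg (Real.log n)]
    have h5 : (n : ℝ) ^ 2 * Real.exp (-(10 ^ 10 * r ^ 2 / 4)) + 0 ≤ 4 / n := by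
      refine le_trans ?_ (failure_bound_le hn le_rfl hrn)
      rw [add_comm]
      refine add_le_add (by positivity) ?_
      gcongr
      linarith
    rw [sensorBound, if_neg h1, if_neg h2]
    exact (tsub_le_tsub_left (ENNReal.ofReal_le_ofReal h5) 1).trans
      (one_sub_le_pointsLaw_of_all (by linarith))

end Asymptotics

end LocalizationRGG

theorem mainTheorem3 (r : ℕ → ℝ)
    (hr : ∀ᶠ n : ℕ in atTop, 70 * √(Real.log n) ≤ r n ∧ r n < √(n : ℝ) / 4) :
    Tendsto
      (fun n : ℕ => LocalizationRGG.pointsLaw n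
        {x | ∀ S ∈ LocalizationRGG.squareFamily n (r n),
          ∃ W : Finset (Fin n),
            (W : Set (Fin n)) ⊆ LocalizationRGG.verticesIn x S ∧
            (W.card : ℝ) ≤ LocalizationRGG.sensorBound n (r n) ∧
            LocalizationRGG.Distinguishes (LocalizationRGG.torusGraph (r n) x) W
              (LocalizationRGG.verticesIn x (S.internal (r n)))})
      atTop (𝓝 1) := by
  have hlog : Tendsto (fun n : ℕ => Real.log n) atTop atTop :=
    Real.tendsto_log_atTop.comp tendsto_natCast_atTop_atTop
  obtain ⟨l₀, hl₀⟩ := eventually_atTop.1 LocalizationRGG.eventually_log_pow_le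
  have hfact : ∀ n : ℕ, 100 ≤ n → Fact (0 < √(n : ℝ)) := fun n hn =>
    ⟨Real.sqrt_pos.2 (by exact_mod_cast (by omega : 0 < n))⟩
  have hlim : Tendsto (fun n : ℕ => 1 - ENNReal.ofReal (4 / (n : ℝ))) atTop (𝓝 1) := by
    have h1 := ENNReal.tendsto_ofReal (tendsto_const_div_atTop_nhds_zero_nat (4 : ℝ))
    rw [ENNReal.ofReal_zero] at h1
    simpa using ENNReal.Tendsto.sub (tendsto_const_nhds (x := (1 : ENNReal))) h1
      (Or.inl ENNReal.one_ne_top)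
  refine tendsto_of_tendsto_of_tendsto_of_le_of_le' hlim tendsto_const_nhds ?_ ?_
  · filter_upwards [hr, eventually_ge_atTop 100, hlog.eventually_ge_atTop (10 ^ 10),
      hlog.eventually_ge_atTop l₀] with n hrn hn h1 h2
    have := hfact n hn
    refine LocalizationRGG.one_sub_le_pointsLaw_sensorBound hn (by linarith)
      (fun l hl => hl₀ l (h2.trans hl)) ?_ hrn.1 hrn.2
    -- Since `log n ≥ 10^10`, the lower bound `70 √(log n)` exceeds the required `10^6`.
    have h3 : (10 ^ 5 : ℝ) ≤ √(Real.log n) := Real.le_sqrt_of_sq_le (by linarith)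
    linarith [hrn.1]
  · filter_upwards [eventually_ge_atTop 100] with n hn
    have := hfact n hn
    have : IsProbabilityMeasure (LocalizationRGG.pointsLaw n) := by
      unfold LocalizationRGG.pointsLaw
      infer_instance
    exact prob_le_one
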